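/- Let $\mathbb{C}((t))$ be the field of formal Laurent series with derivation $\frac{d}{dt}$, and identify $\mathbb{C}(t)$ with a subfield of it by expansion at $0$. For a nonzero $R\in t\,\mathbb{C}[[t]]$ let $\Phi_R$ be the field endomorphism $f(t)\mapsto f(R(t))$ of $\mathbb{C}((t))$. If $R$ vanishes at $0$ to order $d\ge 1$, write $R=t^d v$ with $v(0)\neq 0$. The field $\mathbb{C}((t))(\log t)$ is the purely transcendental extension of $\mathbb{C}((t))$ generated by an element $\log t$; it carries the extension of $\frac{d}{dt}$ with $(\log t)'=\frac1t$ and the extension of $\Phi_R$ with $\Phi_R(\log t)=d\log t+\log v$, where $\log v\in\mathbb{C}[[t]]$ is a determination of the logarithm of $v$. Let $\mathbb{F}=\mathbb{C}((t))$ if $R'(0)\ne 0$ and $\mathbb{F}=\mathbb{C}((t))(\log t)$ if $R'(0)=0$. An element $f$ of $\mathbb{F}$ is \emph{differentially algebraic} over $\mathbb{C}(t)$ if there are an integer $n\ge 0$ and a nonzero polynomial $P$ in $n+1$ variables with coefficients in $\mathbb{C}(t)$ such that $P(f,f',\dots,f^{(n)})=0$, and \emph{differentially transcendental} over $\mathbb{C}(t)$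 otherwise. \textbf{Theorem.} Let $R\in\mathbb{C}(t)$ be nonzero with $R(0)=0$, such that no iterate $R^{\circ n}$, $n\ge 1$, is the identity. Assume $(\mathcal{DT})$: there exists $\Psi\in\mathbb{F}$ with $\Phi_R(\Psi)=R'(t)\,\Psi$ that is differentially transcendental over $\mathbb{C}(t)$ with respect to $\frac{d}{dt}$. Let $a\in\mathbb{C}(t)$ and let $z\in\mathbb{C}((t))$ satisfy $\Phi_R(z)=az$. Then either $z$ is algebraic over $\mathbb{C}(t)$ and there exists a positive integer $N$ such that $z^N\in\mathbb{C}(t)$, or $z$ is differentially transcendental over $\mathbb{C}(t)$. -/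

import Mathlib

open scoped PowerSeries LaurentSeries RatFunc

noncomputable section

namespace IterativeEquation

/-! ### Differentially algebraic and differentially transcendental elements -/

/-- Let `φ : K →+* F` be a field extension and `D` the derivation of `F`. An element `f` of `F` is
differentially algebraic over `K` if `P(f, D f, …, Dⁿ f) = 0` for some `n ≥ 0` and some nonzero
polynomial `P` in `n + 1` variables with coefficients in `K`. -/
def IsDiffAlgebraic {K F : Type*} [Field K] [Field F] (φ : K →+* F) (D : F → F) (f : F) : Prop :=
  ∃ (n : ℕ) (P : MvPolynomial (Fin (n + 1)) K),
    P ≠ 0 ∧ MvPolynomial.eval₂ φ (fun i : Fin (n + 1) => D^[(i : ℕ)] f) P = 0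

/-- An element is differentially transcendental if it is not differentially algebraic. -/
def IsDiffTranscendental {K F : Type*} [Field K] [Field F] (φ : K →+* F) (D : F → F) (f : F) :
    Prop :=
  ¬ IsDiffAlgebraic φ D f

/-! ### The field `ℂ((t))` -/

/-- The expansion at `0`, identifying `ℂ(t)` with a subfield of `ℂ((t))`. -/
def expansion : RatFunc ℂ →+* ℂ⸨X⸩ := algebraMap (RatFunc ℂ) ℂ⸨X⸩

/-- The derivation `d/dt` of `ℂ((t))`. -/
def ddt : ℂ⸨X⸩ → ℂ⸨X⸩ := LaurentSeries.derivative ℂ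

theorem isUnit_subst_X (R : ℂ⟦X⟧) (h0 : PowerSeries.constantCoeff R = 0) (hR : R ≠ 0) :
    IsUnit (((HahnSeries.ofPowerSeries ℤ ℂ).comp
      (PowerSeries.substAlgHom (R := ℂ)
        (PowerSeries.HasSubst.of_constantCoeff_zero' h0)).toRingHom) (PowerSeries.X : ℂ⟦X⟧)) := by
  rw [isUnit_iff_ne_zero]
  have h : (PowerSeries.substAlgHom (R := ℂ)
      (PowerSeries.HasSubst.of_constantCoeff_zero' h0)) (PowerSeries.X : ℂ⟦X⟧) = R :=
    PowerSeries.substAlgHom_X _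
  intro hz
  apply hR
  apply HahnSeries.ofPowerSeries_injective (Γ := ℤ) (R := ℂ)
  rw [map_zero, ← hz]
  exact congrArg _ h.symm

/-- For a nonzero `R ∈ tℂ[[t]]`, the endomorphism `Φ_R : f ↦ f(R(t))` of the field `ℂ((t))`: the
extension of the substitution `f ↦ f(R(t))` of `ℂ[[t]]` to `ℂ((t)) = ℂ[[t]][1/t]`. -/
def Phi (R : ℂ⟦X⟧) (h0 : PowerSeries.constantCoeff R = 0) (hR : R ≠ 0) : ℂ⸨X⸩ →+* ℂ⸨X⸩ :=
  IsLocalization.Away.lift (PowerSeries.X : ℂ⟦X⟧) (isUnit_subst_X R h0 hR)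

/-! ### Purely transcendental extensions `L(T)` -/

/-- The field `L(T)` of rational functions in one variable `T` over the field `L`. -/
abbrev TransExt (L : Type*) [Field L] : Type _ := RatFunc L

/-- `L` as a subfield of `L(T)`. -/
def toTransExt (L : Type*) [Field L] : L →+* TransExt L := RatFunc.C

/-- Given the derivation `D` of a field `L` and `w ∈ L`, the derivation of `L[T]` that extends `D`
and sends `T` to `w`. -/
def polyDeriv {L : Type*} [Field L] (D : L → L) (w : L) (p : Polynomial L) : Polynomial L :=
  p.sum (fun n c => Polynomial.monomial n (D c)) + Polynomial.C w * Polynomial.derivative p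

/-- The derivation of `L(T)` that extends `D` and sends `T` to `w`, by the quotient rule. -/
def ratFuncDeriv {L : Type*} [Field L] (D : L → L) (w : L) (f : TransExt L) : TransExt L :=
  (algebraMap (Polynomial L) (RatFunc L) (polyDeriv D w f.num * f.denom) -
    algebraMap (Polynomial L) (RatFunc L) (f.num * polyDeriv D w f.denom)) /
    algebraMap (Polynomial L) (RatFunc L) (f.denom ^ 2)

theorem eval₂_linear_injective {L : Type*} [Field L] (φ : L →+* L) (c u : L) (hc : c ≠ 0) :
    Function.Injective (Polynomial.eval₂RingHom (Polynomial.C.comp φ)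
      (Polynomial.C c * Polynomial.X + Polynomial.C u)) := by
  have hdeg : (Polynomial.C c * Polynomial.X + Polynomial.C u).natDegree = 1 :=
    Polynomial.natDegree_linear hc
  rw [injective_iff_map_eq_zero]
  intro p hp
  have hcomp : Polynomial.eval₂RingHom (Polynomial.C.comp φ)
      (Polynomial.C c * Polynomial.X + Polynomial.C u) p =
        (p.map φ).comp (Polynomial.C c * Polynomial.X + Polynomial.C u) := by
    simp [Polynomial.comp, Polynomial.eval₂_map]
  rw [hcomp, Polynomial.comp_eq_zero_iff] at hp
  rcases hp with hp | ⟨-, hp⟩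
  · exact (Polynomial.map_eq_zero _).mp hp
  · rw [hp, Polynomial.natDegree_C] at hdeg
    exact absurd hdeg (by norm_num)

/-- The endomorphism of the field `L(T)` that extends the endomorphism `φ` of `L` and sends `T` to
`c T + u`, where `c ≠ 0`. -/
def ratFuncHom {L : Type*} [Field L] (φ : L →+* L) (c u : L) (hc : c ≠ 0) :
    TransExt L →+* TransExt L :=
  RatFunc.mapRingHom
    (Polynomial.eval₂RingHom (Polynomial.C.comp φ)
      (Polynomial.C c * Polynomial.X + Polynomial.C u))
    (nonZeroDivisors_le_comap_nonZeroDivisors_of_injective _ (eval₂_linear_injective φ c u hc))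

/-! ### The field `ℂ((t))(log t)` -/

/-- The field `ℂ((t))(log t)`: the field of rational functions over `ℂ((t))` in one variable `T`,
which stands for `log t`. -/
abbrev LogField : Type := TransExt ℂ⸨X⸩

/-- `ℂ((t))` as a subfield of `ℂ((t))(log t)`. -/
def toLogField : ℂ⸨X⸩ →+* LogField := toTransExt ℂ⸨X⸩

/-- `d/dt` on `ℂ((t))(log t)`: it is `d/dt` on `ℂ((t))`, and `(log t)' = 1/t`. -/
def ddtLog : LogField → LogField := ratFuncDeriv ddt (HahnSeries.single (-1 : ℤ) (1 : ℂ))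

/-- The order `d` of the zero of `R` at `0`. -/
def ord (R : ℂ⟦X⟧) : ℕ := R.order.toNat

/-- The coefficient of `t ^ d` in `R`, where `d` is the order of the zero of `R` at `0`. -/
def leadCoeff (R : ℂ⟦X⟧) : ℂ := PowerSeries.coeff (ord R) R

/-- The power series `log (R / t ^ d)`, where `d` is the order of `R` at `0` and the number `ℓ` is
a logarithm of the leading coefficient `r` of `R`:
`log (R / t ^ d) = ℓ + log (1 + (R / (r t ^ d) - 1))`. -/
def logUnitPart (R : ℂ⟦X⟧) (ℓ : ℂ) : ℂ⟦X⟧ :=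
  PowerSeries.C ℓ +
    PowerSeries.logOf (PowerSeries.C (leadCoeff R)⁻¹ * PowerSeries.divXPowOrder R)

theorem ord_cast_ne_zero (R : ℂ⟦X⟧) (h0 : PowerSeries.constantCoeff R = 0) (hR : R ≠ 0) :
    (HahnSeries.C (ord R : ℂ) : ℂ⸨X⸩) ≠ 0 := by
  have h : ord R ≠ 0 := by
    intro h
    rw [ord, ENat.toNat_eq_zero] at h
    rcases h with h | h
    · exact PowerSeries.order_ne_zero_iff_constCoeff_eq_zero.mpr h0 h
    · exact hR (PowerSeries.order_eq_top.mp h)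
  exact (map_ne_zero _).mpr (Nat.cast_ne_zero.mpr h)

/-- `Φ_R` on the field `ℂ((t))(log t)`: it is `Φ_R` on `ℂ((t))`, and it sends `log t` to
`log (R(t)) = d log t + log (R / t ^ d)`. -/
def PhiLog (R : ℂ⟦X⟧) (h0 : PowerSeries.constantCoeff R = 0) (hR : R ≠ 0) (ℓ : ℂ) :
    LogField →+* LogField :=
  ratFuncHom (Phi R h0 hR) (HahnSeries.C (ord R : ℂ))
    (HahnSeries.ofPowerSeries ℤ ℂ (logUnitPart R ℓ)) (ord_cast_ne_zero R h0 hR)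

/-! ### The standing assumption -/

/-- The iterate `R ∘ ⋯ ∘ R` (`n` factors). -/
def iter (R : ℂ⟦X⟧) : ℕ → ℂ⟦X⟧
  | 0 => PowerSeries.X
  | n + 1 => PowerSeries.subst R (iter R n)

/-- Assumption (DT) on `R`, a rational function identified with its expansion at `0`. The field
that contains `Ψ` is `ℂ((t))` if `R'(0) ≠ 0`, and `ℂ((t))(log t)` if `R'(0) = 0`; in the latter case
any determination of `log (R(t))` is allowed. -/
structure DT (R : ℂ⟦X⟧) : Prop where
  ne_zero : R ≠ 0
  map_zero : PowerSeries.constantCoeff R = 0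
  rational : HahnSeries.ofPowerSeries ℤ ℂ R ∈ expansion.range
  iter_ne : ∀ n : ℕ, 0 < n → iter R n ≠ PowerSeries.X
  exists_psi :
    (PowerSeries.coeff 1 R ≠ 0 ∧ ∃ Ψ : ℂ⸨X⸩,
      Phi R map_zero ne_zero Ψ =
        HahnSeries.ofPowerSeries ℤ ℂ (PowerSeries.derivative ℂ R) * Ψ ∧
      IsDiffTranscendental expansion ddt Ψ) ∨
    (PowerSeries.coeff 1 R = 0 ∧ ∃ ℓ : ℂ, Complex.exp ℓ = leadCoeff R ∧ ∃ Ψ : LogField,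
      PhiLog R map_zero ne_zero ℓ Ψ =
        toLogField (HahnSeries.ofPowerSeries ℤ ℂ (PowerSeries.derivative ℂ R)) * Ψ ∧
      IsDiffTranscendental (toLogField.comp expansion) ddtLog Ψ)

end IterativeEquation

end

/-! ### Algebraic relations between solutions of `φ u - u = b` -/

namespace MvPolynomial

variable {ι L : Type*} [Field L]

/-- The ring endomorphism of `L[X_i]` acting as `φ` on the coefficients and as `X_i ↦ X_i + b_i` on
the variables. -/
noncomputable def twistedShift (φ : L →+* L) (b : ι → L) : MvPolynomial ι L →+* MvPolynomial ι L :=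
  eval₂Hom (C.comp φ) (fun i => X i + C (b i))

@[simp] lemma twistedShift_C (φ : L →+* L) (b : ι → L) (c : L) :
    twistedShift φ b (C c) = C (φ c) := by simp [twistedShift]

@[simp] lemma twistedShift_X (φ : L →+* L) (b : ι → L) (i : ι) :
    twistedShift φ b (X i) = X i + C (b i) := by simp [twistedShift]

lemma aeval_twistedShift {F : Type*} [Field F] [Algebra L F] {φ : L →+* L} {Φ : F →+* F}
    (hΦ : ∀ x, Φ (algebraMap L F x) = algebraMap L F (φ x)) {b : ι → L} {u : ι → F}
    (hu : ∀ i, Φ (u i) = u i + algebraMap L F (b i)) (P : MvPolynomial ι L) :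
    aeval u (twistedShift φ b P) = Φ (aeval u P) := by
  induction P using MvPolynomial.induction_on with
  | C c => simp [hΦ]
  | add p q hp hq => simp [hp, hq]
  | mul_X p i hp => simp [hp, hu]

lemma pderiv_twistedShift (φ : L →+* L) (b : ι → L) (i : ι) (P : MvPolynomial ι L) :
    pderiv i (twistedShift φ b P) = twistedShift φ b (pderiv i P) := by
  classical
  induction P using MvPolynomial.induction_on with
  | C c => simp
  | add p q hp hq => simp [hp, hq]
  | mul_X p j hp =>
    simp only [map_mul, Derivation.leibniz, hp, smul_eq_mul, twistedShift_X, map_add, pderiv_C,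
      add_zero, pderiv_X]
    congr 2
    by_cases h : i = j <;> simp [h]

lemma twistedShift_monomial_sub (φ : L →+* L) (b : ι → L) (m : ι →₀ ℕ) (c : L) :
    ∀ m' : ι →₀ ℕ, m.degree ≤ m'.degree →
      coeff m' (twistedShift φ b (monomial m c) - monomial m (φ c)) = 0 := by
  classical
  suffices H : ∀ (n : ℕ) (m : ι →₀ ℕ), m.degree = n → ∀ m' : ι →₀ ℕ, n ≤ m'.degree →
      coeff m' (twistedShift φ b (monomial m c) - monomial m (φ c)) = 0 from
    H _ m rfl
  intro n
  induction n with
  | zero =>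
    intro m hm m' _
    obtain rfl : m = 0 := by simpa [Finsupp.degree_eq_zero_iff] using hm
    have h : ∀ a : L, monomial (0 : ι →₀ ℕ) a = C a := fun _ => rfl
    simp [h]
  | succ n ih =>
    intro m hm m' hm'
    obtain ⟨i, hi⟩ : ∃ i, m i ≠ 0 := by
      by_contra! h
      have : m = 0 := Finsupp.ext h
      simp [this] at hm
    obtain ⟨k, rfl⟩ : ∃ k, m = k + Finsupp.single i 1 :=
      ⟨m - Finsupp.single i 1, (tsub_add_cancel_of_le (by
        simpa [Finsupp.single_le_iff] using Nat.one_le_iff_ne_zero.mpr hi)).symm⟩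
    have hk : k.degree = n := by simpa using hm
    have e : ∀ a : L, monomial (k + Finsupp.single i 1) a = monomial k a * X i := fun a => by
      simp [X, monomial_mul]
    have e2 : twistedShift φ b (monomial (k + Finsupp.single i 1) c) -
        monomial (k + Finsupp.single i 1) (φ c) =
        (twistedShift φ b (monomial k c) - monomial k (φ c)) * X i +
        (twistedShift φ b (monomial k c) - monomial k (φ c)) * C (b i) +
        monomial k (φ c) * C (b i) := by
      rw [e, e, map_mul, twistedShift_X]; ring
    rw [e2, coeff_add, coeff_add, coeff_mul_X', mul_comm _ (C (b i)), mul_comm _ (C (b i)),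
      coeff_C_mul, coeff_C_mul,
      ih k hk m' (by omega), coeff_monomial, if_neg (show k ≠ m' by rintro rfl; omega), mul_zero,
      add_zero, add_zero]
    split_ifs with h
    · refine ih k hk _ ?_
      have : m' = (m' - Finsupp.single i 1) + Finsupp.single i 1 :=
        (tsub_add_cancel_of_le (by
          simpa [Finsupp.single_le_iff, Nat.one_le_iff_ne_zero] using h)).symm
      rw [this] at hm'
      simpa using hm'
    · rfl

lemma coeff_twistedShift (φ : L →+* L) (b : ι → L) (P : MvPolynomial ι L) (m : ι →₀ ℕ)
    (hm : P.totalDegree ≤ m.degree) : coeff m (twistedShift φ b P) = φ (coeff m P) := by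
  classical
  have h1 : twistedShift φ b P = ∑ k ∈ P.support, twistedShift φ b (monomial k (coeff k P)) := by
    conv_lhs => rw [P.as_sum, map_sum]
  have h2 : coeff m (map φ P) = ∑ k ∈ P.support, coeff m (monomial k (φ (coeff k P))) := by
    conv_lhs => rw [P.as_sum, map_sum, coeff_sum]
    simp
  rw [← coeff_map, h2, h1, coeff_sum]
  refine Finset.sum_congr rfl fun k hk => ?_
  rw [← sub_eq_zero, ← coeff_sub]
  exact twistedShift_monomial_sub φ b k _ m ((le_totalDegree hk).trans hm)

lemma exists_coeff_ne_zero_degree_eq (P : MvPolynomial ι L) (hP : P ≠ 0) :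
    ∃ m, coeff m P ≠ 0 ∧ m.degree = P.totalDegree := by
  obtain ⟨m, hm, h⟩ := Finset.exists_mem_eq_sup P.support (support_nonempty.mpr hP)
    (fun s => s.sum fun _ e => e)
  exact ⟨m, mem_support_iff.mp hm, h.symm⟩

/-- The number of monomials of top degree of a polynomial. -/
noncomputable def topCard (P : MvPolynomial ι L) : ℕ :=
  (P.support.filter fun m => m.degree = P.totalDegree).card

/-- If the `u i` are algebraically dependent over `L`, then some nonconstant polynomial is invariant
under the twisted shift. -/
lemma exists_twistedShift_eq_self {F : Type*} [Field F] [Algebra L F] {φ : L →+* L} {Φ : F →+* F}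
    (hΦ : ∀ x, Φ (algebraMap L F x) = algebraMap L F (φ x)) {b : ι → L} {u : ι → F}
    (hu : ∀ i, Φ (u i) = u i + algebraMap L F (b i))
    (hdep : ¬ AlgebraicIndependent L u) :
    ∃ P : MvPolynomial ι L, P.totalDegree ≠ 0 ∧ twistedShift φ b P = P := by
  classical
  rw [algebraicIndependent_iff] at hdep
  push Not at hdep
  obtain ⟨P₀, hP₀, hP₀'⟩ := hdep
  obtain ⟨P, ⟨hP0, hP⟩, hmin⟩ := (InvImage.wf (fun P : MvPolynomial ι L =>
    toLex (P.totalDegree, topCard P)) wellFounded_lt).has_min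
      {P : MvPolynomial ι L | P ≠ 0 ∧ aeval u P = 0} ⟨P₀, hP₀', hP₀⟩
  obtain ⟨m₀, hm₀, hdeg⟩ := exists_coeff_ne_zero_degree_eq P hP0
  set c := coeff m₀ P with hc
  have hφc : φ c ≠ 0 := (map_ne_zero φ).mpr hm₀
  set Q := C c * twistedShift φ b P - C (φ c) * P with hQ
  have hQu : aeval u Q = 0 := by
    simp [hQ, aeval_twistedShift hΦ hu, hP]
  have hQdeg : Q.totalDegree ≤ P.totalDegree := by
    refine Finset.sup_le fun m hm => ?_
    by_contra! h
    change P.totalDegree < m.degree at h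
    rw [mem_support_iff, hQ, coeff_sub, coeff_C_mul, coeff_C_mul,
      coeff_twistedShift φ b P m h.le, coeff_eq_zero_of_totalDegree_lt h] at hm
    simp at hm
  have hQ0 : Q = 0 := by
    by_contra hne
    refine hmin Q ⟨hne, hQu⟩ ?_
    change toLex (Q.totalDegree, topCard Q) < toLex (P.totalDegree, topCard P)
    rw [Prod.Lex.toLex_lt_toLex]
    rcases hQdeg.lt_or_eq with h | h
    · exact Or.inl h
    · refine Or.inr ⟨h, Finset.card_lt_card ?_⟩
      rw [Finset.ssubset_iff_of_subset]
      · refine ⟨m₀, by simpa [← hdeg] using hm₀, ?_⟩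
        rw [Finset.mem_filter, mem_support_iff, hQ, coeff_sub, coeff_C_mul, coeff_C_mul,
          coeff_twistedShift φ b P m₀ hdeg.ge]
        simp [mul_comm, ← hc]
      · intro m hm
        rw [Finset.mem_filter, mem_support_iff] at hm ⊢
        refine ⟨fun h0 => hm.1 ?_, h ▸ hm.2⟩
        rw [hQ, coeff_sub, coeff_C_mul, coeff_C_mul,
          coeff_twistedShift φ b P m (by rw [hm.2, h]), h0]
        simp
  refine ⟨C c⁻¹ * P, fun h => ?_, ?_⟩
  · rw [totalDegree_eq_zero_iff_eq_C] at h
    have h1 : aeval u (C c⁻¹ * P) = 0 := by simp [hP]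
    rw [h, aeval_C, map_eq_zero] at h1
    rw [h1, C_0, mul_eq_zero, C_eq_zero] at h
    exact h.elim (inv_ne_zero hm₀) hP0
  · have h1 : C c * twistedShift φ b P = C (φ c) * P := sub_eq_zero.mp hQ0
    rw [map_mul, twistedShift_C]
    have h2 : C c * (C (φ c⁻¹) * twistedShift φ b P) = C c * (C c⁻¹ * P) := by
      rw [mul_left_comm, h1, ← mul_assoc, ← mul_assoc, ← C_mul, ← C_mul, ← map_mul,
        inv_mul_cancel₀ hm₀, mul_inv_cancel₀ hm₀, map_one]
    exact mul_left_cancel₀ (by simpa using hm₀) h2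

lemma exists_twistedShift_eq_self_totalDegree_eq_one [CharZero L] {φ : L →+* L} {b : ι → L}
    (P : MvPolynomial ι L) (hdeg : P.totalDegree ≠ 0) (hP : twistedShift φ b P = P) :
    ∃ Q : MvPolynomial ι L, Q.totalDegree = 1 ∧ twistedShift φ b Q = Q := by
  classical
  induction hn : P.totalDegree using Nat.strong_induction_on generalizing P with
  | _ n ih =>
  by_cases h1 : P.totalDegree = 1
  · exact ⟨P, h1, hP⟩
  obtain ⟨m, hm, hmd⟩ := exists_coeff_ne_zero_degree_eq P (by rintro rfl; simp at hdeg)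
  obtain ⟨i, hi⟩ : ∃ i, m i ≠ 0 := by
    by_contra! h
    have : m = 0 := Finsupp.ext h
    rw [this] at hmd
    simp at hmd; omega
  obtain ⟨k, rfl⟩ : ∃ k, m = k + Finsupp.single i 1 :=
    ⟨m - Finsupp.single i 1, (tsub_add_cancel_of_le (by
      simpa [Finsupp.single_le_iff] using Nat.one_le_iff_ne_zero.mpr hi)).symm⟩
  have hk : k.degree + 1 = P.totalDegree := by simpa using hmd
  have hlt : (pderiv i P).totalDegree < P.totalDegree := by
    refine (Finset.sup_lt_iff (Nat.pos_of_ne_zero hdeg)).mpr fun m hm => ?_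
    rw [mem_support_iff, coeff_pderiv] at hm
    have := le_totalDegree (mem_support_iff.mpr (left_ne_zero_of_mul hm))
    change (m + Finsupp.single i 1).degree ≤ _ at this
    change m.degree < _
    rw [map_add, Finsupp.degree_single] at this
    omega
  refine ih _ (hn ▸ hlt) (pderiv i P) ?_ (by rw [← pderiv_twistedShift, hP]) rfl
  have hc : coeff k (pderiv i P) ≠ 0 := by
    rw [coeff_pderiv]
    exact mul_ne_zero hm (Nat.cast_add_one_ne_zero _)
  have := le_totalDegree (mem_support_iff.mpr hc)
  change k.degree ≤ _ at this
  omega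

lemma eq_C_add_sum_of_totalDegree_le_one [Fintype ι] (P : MvPolynomial ι L)
    (hP : P.totalDegree ≤ 1) :
    P = C (coeff 0 P) + ∑ i, C (coeff (Finsupp.single i 1) P) * X i := by
  classical
  ext m
  rw [coeff_add, coeff_C, coeff_sum]
  simp only [coeff_C_mul, coeff_X]
  rcases Nat.lt_or_ge 1 m.degree with h | h
  · rw [coeff_eq_zero_of_totalDegree_lt (lt_of_le_of_lt hP h), if_neg, Finset.sum_eq_zero]
    · simp
    · intro i _
      rw [if_neg, mul_zero]
      rintro rfl
      simp at h
    · rintro rfl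
      simp at h
  · by_cases h0 : m = 0
    · subst h0
      rw [if_pos rfl, Finset.sum_eq_zero, add_zero]
      intro i _
      simp
    · obtain ⟨i, hi⟩ : ∃ i, m i ≠ 0 := by
        by_contra! h
        exact h0 (Finsupp.ext h)
      obtain ⟨k, rfl⟩ : ∃ k, m = k + Finsupp.single i 1 :=
        ⟨m - Finsupp.single i 1, (tsub_add_cancel_of_le (by
          simpa [Finsupp.single_le_iff] using Nat.one_le_iff_ne_zero.mpr hi)).symm⟩
      obtain rfl : k = 0 := by
        rw [map_add, Finsupp.degree_single] at h
        exact (Finsupp.degree_eq_zero_iff k).mp (by omega)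
      rw [if_neg (Ne.symm h0), zero_add, zero_add, Finset.sum_eq_single i]
      · simp
      · intro j _ hj
        rw [if_neg, mul_zero]
        intro h
        exact hj (Finsupp.single_left_injective one_ne_zero h)
      · simp

end MvPolynomial

/-- If `Φ (u i) - u i ∈ L` and the `u i` are algebraically dependent over `L`, which contains the
field of elements fixed by `Φ`, then a nontrivial linear combination of the `u i` with coefficients
fixed by `Φ` lies in `L`. -/
theorem exists_sum_mem_of_not_algebraicIndependent {ι L F : Type*} [Fintype ι] [Field L] [Field F]
    [CharZero L] [Algebra L F] {φ : L →+* L} {Φ : F →+* F}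
    (hΦ : ∀ x, Φ (algebraMap L F x) = algebraMap L F (φ x))
    (hfix : ∀ x, Φ x = x → x ∈ (algebraMap L F).range) {b : ι → L} {u : ι → F}
    (hu : ∀ i, Φ (u i) = u i + algebraMap L F (b i))
    (hdep : ¬ AlgebraicIndependent L u) :
    ∃ c : ι → L, c ≠ 0 ∧ (∀ i, φ (c i) = c i) ∧
      ∃ g : L, ∑ i, algebraMap L F (c i) * u i = algebraMap L F g := by
  obtain ⟨P₀, hP₀, hP₀'⟩ := MvPolynomial.exists_twistedShift_eq_self hΦ hu hdep
  obtain ⟨P, hdeg, hP⟩ :=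
    MvPolynomial.exists_twistedShift_eq_self_totalDegree_eq_one P₀ hP₀ hP₀'
  have hsum := MvPolynomial.eq_C_add_sum_of_totalDegree_le_one P hdeg.le
  obtain ⟨g, hg⟩ := hfix (MvPolynomial.aeval u P) (by
    rw [← MvPolynomial.aeval_twistedShift hΦ hu, hP])
  refine ⟨fun i => MvPolynomial.coeff (Finsupp.single i 1) P, fun h => ?_, fun i => ?_,
    g - MvPolynomial.coeff 0 P, ?_⟩
  · have h' : ∀ i, MvPolynomial.coeff (Finsupp.single i 1) P = 0 := fun i => congrFun h i
    simp only [h', map_zero, zero_mul, Finset.sum_const_zero, add_zero] at hsum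
    rw [hsum] at hdeg
    simp at hdeg
  · rw [← MvPolynomial.coeff_twistedShift φ b P _ (by simp [hdeg]), hP]
  · have h := congrArg (MvPolynomial.aeval u) hsum
    rw [map_sub, hg, h]
    simp

/-! ### Differentially algebraic elements -/

namespace IterativeEquation

open IntermediateField

section

variable {K F : Type*} [Field K] [Field F] [Algebra K F]

lemma algebraicIndependent_nat_iff {x : ℕ → F} :
    AlgebraicIndependent K x ↔ ∀ n : ℕ, AlgebraicIndependent K fun i : Fin n => x i := by
  refine ⟨fun h n => h.comp _ Fin.val_injective, fun h => ?_⟩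
  rw [algebraicIndependent_iff]
  intro P hP
  obtain ⟨n, hn⟩ : ∃ n : ℕ, ∀ i ∈ P.vars, i < n := by
    refine ⟨P.vars.sup id + 1, fun i hi => Nat.lt_succ_of_le (Finset.le_sup (f := id) hi)⟩
  obtain ⟨Q, rfl⟩ := MvPolynomial.exists_rename_eq_of_vars_subset_range P
    (Fin.val : Fin n → ℕ) Fin.val_injective (fun i hi => ⟨⟨i, hn i hi⟩, rfl⟩)
  rw [MvPolynomial.aeval_rename] at hP
  rw [algebraicIndependent_iff.mp (h n) Q hP, map_zero]

lemma isDiffTranscendental_iff (D : F → F) (f : F) :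
    IsDiffTranscendental (algebraMap K F) D f ↔ AlgebraicIndependent K fun i : ℕ => D^[i] f := by
  rw [algebraicIndependent_nat_iff]
  constructor
  · intro h n
    rw [algebraicIndependent_iff]
    intro P hP
    by_contra h0
    refine h ⟨n, MvPolynomial.rename Fin.castSucc P, ?_, ?_⟩
    · exact fun h1 => h0 (MvPolynomial.rename_injective _ (Fin.castSucc_injective n)
        (h1.trans (map_zero _).symm))
    · rw [← MvPolynomial.aeval_def, MvPolynomial.aeval_rename]
      exact hP
  · rintro h ⟨n, P, hP, h0⟩
    exact hP (algebraicIndependent_iff.mp (h (n + 1)) P h0)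

lemma not_algebraicIndependent_of_finTrdeg {E : IntermediateField K F} [FinTrdeg K E]
    {x : ℕ → F} (hx : ∀ i, x i ∈ E) : ¬ AlgebraicIndependent K x := by
  intro h
  have h2 : AlgebraicIndependent K (fun i => (⟨x i, hx i⟩ : E)) :=
    AlgebraicIndependent.of_comp E.val h
  have := finite_of_algebraicIndependent h2
  exact not_finite ℕ

variable (δ : Derivation ℤ F F)

lemma derivation_inv_mem {E : Subfield F} {x : F} (hx : x ∈ E) (hδ : δ x ∈ E) : δ x⁻¹ ∈ E := by
  rw [Derivation.leibniz_inv]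
  exact E.mul_mem (E.neg_mem (E.pow_mem (E.inv_mem hx) 2)) hδ

lemma derivation_mem_of_mem_adjoin (hK : ∀ k : K, δ (algebraMap K F k) ∈ (algebraMap K F).range)
    {S : Set F} {E : IntermediateField K F} (hS : S ⊆ E) (hδS : ∀ s ∈ S, δ s ∈ E)
    {x : F} (hx : x ∈ adjoin K S) : δ x ∈ E := by
  have hle : adjoin K S ≤ E := adjoin_le_iff.mpr hS
  induction hx using adjoin_induction with
  | mem x hx => exact hδS x hx
  | algebraMap k =>
    obtain ⟨k', hk'⟩ := hK k
    rw [← hk']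
    exact E.algebraMap_mem k'
  | add x y _ _ hx hy => rw [map_add]; exact E.add_mem hx hy
  | inv x hx ih => exact derivation_inv_mem δ (E := E.toSubfield) (hle hx) ih
  | mul x y hx hy ihx ihy =>
    rw [Derivation.leibniz]
    exact E.add_mem (E.mul_mem (hle hx) ihy) (E.mul_mem (hle hy) ihx)

lemma derivation_mem_of_isAlgebraic [CharZero F] {E E' : IntermediateField K F} (hle : E ≤ E')
    (hE : ∀ x ∈ E, δ x ∈ E') {x : F} (hx : x ∈ E') (halg : IsAlgebraic E x) : δ x ∈ E' := by
  have key : ∀ p : Polynomial E,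
      δ (Polynomial.aeval x p) - Polynomial.aeval x p.derivative * δ x ∈ E' := by
    intro p
    induction p using Polynomial.induction_on' with
    | add p q hp hq =>
      have := E'.add_mem hp hq
      convert this using 1
      simp only [map_add]
      ring
    | monomial n a =>
      have : δ (Polynomial.aeval x (Polynomial.monomial n a)) -
          Polynomial.aeval x (Polynomial.monomial n a).derivative * δ x = x ^ n * δ (a : F) := by
        rw [Polynomial.aeval_monomial, Polynomial.derivative_monomial, Polynomial.aeval_monomial,
          Derivation.leibniz, Derivation.leibniz_pow]
        simp [smul_eq_mul, IntermediateField.algebraMap_apply]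
        ring
      rw [this]
      exact E'.mul_mem (pow_mem hx n) (hE _ a.2)
  have hxint : IsIntegral E x := halg.isIntegral
  have h0 := key (minpoly E x)
  rw [minpoly.aeval, map_zero, zero_sub] at h0
  have hne : Polynomial.aeval x (minpoly E x).derivative ≠ 0 :=
    (minpoly.irreducible hxint).separable.aeval_derivative_ne_zero (minpoly.aeval E x)
  have hmem : Polynomial.aeval x (minpoly E x).derivative ∈ E' := by
    rw [Polynomial.aeval_eq_sum_range]
    refine E'.sum_mem fun i _ => ?_
    rw [Algebra.smul_def]
    exact E'.mul_mem (hle (Subtype.mem _)) (pow_mem hx i)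
  have := E'.div_mem (E'.neg_mem h0) hmem
  rwa [neg_neg, mul_div_cancel_left₀ _ hne] at this

/-- A differentially algebraic element lies in a finitely generated differential subfield. -/
theorem exists_fg_differential_subfield [CharZero F]
    (hK : ∀ k : K, δ (algebraMap K F k) ∈ (algebraMap K F).range) {f : F}
    (hf : ¬ AlgebraicIndependent K fun i : ℕ => δ^[i] f) :
    ∃ M : IntermediateField K F, M.FG ∧ f ∈ M ∧ ∀ x ∈ M, δ x ∈ M := by
  set x : ℕ → F := fun i => δ^[i] f with hxdef
  have hsucc : ∀ i, δ (x i) = x (i + 1) := fun i => (Function.iterate_succ_apply' δ i f).symm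
  obtain ⟨n, hn⟩ : ∃ n, IsAlgebraic (Algebra.adjoin K (x '' Set.Iio n)) (x n) := by
    by_contra! h
    refine hf (algebraicIndependent_nat_iff.mpr fun n => ?_)
    have h2 : ∀ n : ℕ, AlgebraicIndepOn K x (Set.Iio n) := by
      intro n
      induction n with
      | zero =>
        have : Set.Iio 0 = (∅ : Set ℕ) := by ext; simp
        rw [this]
        have : IsEmpty (∅ : Set ℕ) := inferInstance
        exact algebraicIndependent_empty_type
      | succ n ih =>
        have : Set.Iio (n + 1) = insert n (Set.Iio n) := by ext; simp
        rw [this]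
        exact ih.insert (h n)
    exact (h2 n).comp (fun i : Fin n => (⟨i, i.2⟩ : Set.Iio n)) fun i j hij =>
      Fin.ext (congrArg Subtype.val hij)
  have hle : adjoin K (x '' Set.Iio n) ≤ adjoin K (x '' Set.Iio (n + 1)) :=
    adjoin.mono _ _ _ (Set.image_mono fun i (hi : i < n) => (Nat.lt_succ_of_lt hi : i < n + 1))
  have hmem : ∀ i < n + 1, x i ∈ adjoin K (x '' Set.Iio (n + 1)) := fun i hi =>
    subset_adjoin _ _ ⟨i, hi, rfl⟩
  have hδn : δ (x n) ∈ adjoin K (x '' Set.Iio (n + 1)) := by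
    refine derivation_mem_of_isAlgebraic δ hle (fun y hy => ?_) (hmem n (by omega))
      (IsAlgebraic.tower_top_of_subalgebra_le (B := (adjoin K (x '' Set.Iio n)).toSubalgebra)
        (algebra_adjoin_le_adjoin K _) hn)
    refine derivation_mem_of_mem_adjoin δ hK ?_ ?_ hy
    · rintro _ ⟨i, hi, rfl⟩
      exact hmem i (Nat.lt_succ_of_lt hi)
    · rintro _ ⟨i, hi, rfl⟩
      rw [hsucc]
      exact hmem (i + 1) (Nat.succ_lt_succ hi)
  refine ⟨adjoin K (x '' Set.Iio (n + 1)),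
    fg_adjoin_of_finite ((Set.finite_Iio _).image _), hmem 0 (by omega), fun y hy =>
    derivation_mem_of_mem_adjoin δ hK (subset_adjoin _ _) ?_ hy⟩
  rintro _ ⟨i, hi, rfl⟩
  rcases Nat.lt_succ_iff_lt_or_eq.mp hi with h | rfl
  · rw [hsucc]
    exact hmem (i + 1) (Nat.succ_lt_succ h)
  · exact hδn

lemma iterate_mem {M : IntermediateField K F} (hM : ∀ x ∈ M, δ x ∈ M) {x : F} (hx : x ∈ M)
    (i : ℕ) : δ^[i] x ∈ M := by
  induction i with
  | zero => exact hx
  | succ i ih => rw [Function.iterate_succ_apply']; exact hM _ ih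

/-- A differentially transcendental element remains so over a finitely generated differential
extension of the base field. -/
theorem algebraicIndependent_of_fg [CharZero F] {f : F}
    (hf : AlgebraicIndependent K fun i : ℕ => δ^[i] f) {M : IntermediateField K F} (hfg : M.FG)
    (hM : ∀ x ∈ M, δ x ∈ M) : AlgebraicIndependent M fun i : ℕ => δ^[i] f := by
  by_contra h
  obtain ⟨E, hEfg, hfE, hE⟩ := exists_fg_differential_subfield δ
    (fun k : M => ⟨⟨_, hM _ k.2⟩, rfl⟩) h
  have : Algebra.EssFiniteType K M := essFiniteType_iff.mpr hfg
  have : Algebra.EssFiniteType M E := essFiniteType_iff.mpr hEfg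
  have : FinTrdeg K E := FinTrdeg.trans K M E
  have : FinTrdeg K (E.restrictScalars K) := this
  exact not_algebraicIndependent_of_finTrdeg (E := E.restrictScalars K)
    (fun i => iterate_mem δ hE hfE i) hf

end

end IterativeEquation

namespace MvPolynomial

/-- If a product of a nonzero polynomial over `K` and a polynomial over an extension `M` has
coefficients in `K`, then so does the second factor. -/
lemma exists_map_eq_of_mul_eq {ι K M : Type*} [Field K] [Field M] [Algebra K M]
    {P Q : MvPolynomial ι K} (hQ : Q ≠ 0) {S : MvPolynomial ι M}
    (h : map (algebraMap K M) Q * S = map (algebraMap K M) P) :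
    ∃ T : MvPolynomial ι K, map (algebraMap K M) T = S := by
  classical
  obtain ⟨π, hπ⟩ := (Algebra.linearMap K M).exists_leftInverse_of_injective
    (LinearMap.ker_eq_bot.mpr (algebraMap K M).injective)
  have hπ' : ∀ k : K, π (algebraMap K M k) = k := fun k => LinearMap.congr_fun hπ k
  let T : MvPolynomial ι K := ∑ m ∈ S.support, monomial m (π (coeff m S))
  have hT : ∀ m, coeff m T = π (coeff m S) := by
    intro m
    simp only [T, coeff_sum, coeff_monomial, Finset.sum_ite_eq', mem_support_iff]
    split_ifs with h0
    · rfl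
    · rw [not_not.mp h0, map_zero]
  have hQT : Q * T = P := by
    ext m
    have hm := congrArg (fun p => π (coeff m p)) h
    simp only [coeff_mul, coeff_map, hπ', map_sum] at hm
    rw [coeff_mul, ← hm]
    refine Finset.sum_congr rfl fun x _ => ?_
    rw [hT, ← Algebra.smul_def, map_smul, smul_eq_mul]
  refine ⟨T, ?_⟩
  have h0 : map (algebraMap K M) Q ≠ 0 := fun h1 =>
    hQ (map_injective _ (algebraMap K M).injective (h1.trans (map_zero _).symm))
  refine mul_left_cancel₀ h0 ?_
  rw [h, ← map_mul, hQT]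

end MvPolynomial

namespace IterativeEquation

open IntermediateField

section

variable {K F : Type*} [Field K] [Field F] [Algebra K F] (δ : Derivation ℤ F F)

lemma map_mem_of_mem_adjoin (Φ : F →+* F)
    (hK : ∀ k : K, Φ (algebraMap K F k) ∈ (algebraMap K F).range)
    {S : Set F} {E : IntermediateField K F} (hS : ∀ s ∈ S, Φ s ∈ E)
    {x : F} (hx : x ∈ adjoin K S) : Φ x ∈ E := by
  induction hx using adjoin_induction with
  | mem x hx => exact hS x hx
  | algebraMap k =>
    obtain ⟨k', hk'⟩ := hK k
    rw [← hk']
    exact E.algebraMap_mem k'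
  | add x y _ _ hx hy => rw [map_add]; exact E.add_mem hx hy
  | inv x _ ih => rw [map_inv₀]; exact E.inv_mem ih
  | mul x y _ _ ihx ihy => rw [map_mul]; exact E.mul_mem ihx ihy

lemma derivation_mem_of_mem_algebra_adjoin {M : IntermediateField K F}
    (hM : ∀ x ∈ M, δ x ∈ M) {S : Set F} {A : Subalgebra M F} (hS : S ⊆ A)
    (hδS : ∀ s ∈ S, δ s ∈ A) {x : F} (hx : x ∈ Algebra.adjoin M S) : δ x ∈ A := by
  have hle : Algebra.adjoin M S ≤ A := Algebra.adjoin_le hS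
  induction hx using Algebra.adjoin_induction with
  | mem x hx => exact hδS x hx
  | algebraMap k => exact A.algebraMap_mem ⟨_, hM _ k.2⟩
  | add x y _ _ hx hy => rw [map_add]; exact A.add_mem hx hy
  | mul x y hx hy ihx ihy =>
    rw [Derivation.leibniz]
    exact A.add_mem (A.mul_mem (hle hx) ihy) (A.mul_mem (hle hy) ihx)

/-- The leading part of `(Ψ δ)ⁱ (Ψ y)` with respect to `δⁱ Ψ`. -/
lemma iterate_sub_mem_adjoin {M : IntermediateField K F} (hM : ∀ x ∈ M, δ x ∈ M)
    (Ψ : F) {y : F} (hy : y ∈ M) (i : ℕ) :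
    (fun x => Ψ * δ x)^[i] (Ψ * y) - y * Ψ ^ i * δ^[i] Ψ ∈
      Algebra.adjoin M ((fun j => δ^[j] Ψ) '' Set.Iio i) := by
  induction i with
  | zero => simp [mul_comm]
  | succ i ih =>
    set A := Algebra.adjoin M ((fun j => δ^[j] Ψ) '' Set.Iio i)
    set A' := Algebra.adjoin M ((fun j => δ^[j] Ψ) '' Set.Iio (i + 1))
    have hmem : ∀ j < i + 1, δ^[j] Ψ ∈ A' := fun j hj => Algebra.subset_adjoin ⟨j, hj, rfl⟩
    have hδ : ∀ x ∈ A, δ x ∈ A' := fun x hx => by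
      refine derivation_mem_of_mem_algebra_adjoin δ hM ?_ ?_ hx
      · rintro _ ⟨j, hj, rfl⟩
        exact hmem j (Nat.lt_succ_of_lt hj)
      · rintro _ ⟨j, hj, rfl⟩
        change δ (δ^[j] Ψ) ∈ A'
        rw [← Function.iterate_succ_apply' δ j Ψ]
        exact hmem (j + 1) (Nat.succ_lt_succ hj)
    have hΨ : Ψ ∈ A' := hmem 0 (by omega)
    have hM' : ∀ x ∈ M, x ∈ A' := fun x hx => A'.algebraMap_mem ⟨x, hx⟩
    have hpow : δ (Ψ ^ i) ∈ A' := by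
      rcases Nat.eq_zero_or_pos i with rfl | hi
      · simp
      · exact hδ _ (A.pow_mem (Algebra.subset_adjoin ⟨0, hi, rfl⟩) i)
    have hstep : (fun x => Ψ * δ x)^[i + 1] (Ψ * y) - y * Ψ ^ (i + 1) * δ^[i + 1] Ψ =
        Ψ * (δ ((fun x => Ψ * δ x)^[i] (Ψ * y) - y * Ψ ^ i * δ^[i] Ψ) +
          δ y * Ψ ^ i * δ^[i] Ψ + y * δ (Ψ ^ i) * δ^[i] Ψ) := by
      rw [Function.iterate_succ_apply', Function.iterate_succ_apply' δ i Ψ, map_sub]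
      simp only [Derivation.leibniz, smul_eq_mul]
      ring
    rw [hstep]
    refine A'.mul_mem hΨ (A'.add_mem (A'.add_mem (hδ _ ih) ?_) ?_)
    · exact A'.mul_mem (A'.mul_mem (hM' _ (hM _ hy)) (A'.pow_mem hΨ i)) (hmem i (by omega))
    · exact A'.mul_mem (A'.mul_mem (hM' _ hy) hpow) (hmem i (by omega))

/-- If `Ψ` is differentially transcendental over `M ⊇ K` and the element `c y Ψᴺ Ψ⁽ᴺ⁾ + w` lies in
`K(Ψ, Ψ', …)`, where `c y ∈ M` and `w ∈ M[Ψ, …, Ψ⁽ᴺ⁻¹⁾]`, then `c y ∈ K`. -/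
lemma mem_range_of_leading_term_add_mem {M : IntermediateField K F} {x : ℕ → F}
    (hx : AlgebraicIndependent M x) {y w : F} (hy : y ∈ M) {N : ℕ}
    (hw : w ∈ Algebra.adjoin M (x '' Set.Iio N))
    (hg : y * x 0 ^ N * x N + w ∈ adjoin K (Set.range x)) : y ∈ (algebraMap K F).range := by
  classical
  have himg : x '' Set.Iio N = Set.range fun i : Fin N => x i := by
    ext a
    constructor
    · rintro ⟨i, hi, rfl⟩
      exact ⟨⟨i, hi⟩, rfl⟩
    · rintro ⟨i, rfl⟩
      exact ⟨i, i.2, rfl⟩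
  rw [himg, Algebra.adjoin_range_eq_range_aeval] at hw
  obtain ⟨B, hB⟩ := hw
  replace hB : MvPolynomial.aeval (fun i : Fin N => x i) B = w := hB
  subst hB
  obtain ⟨P, Q, hQ, hPQ⟩ : ∃ P Q : MvPolynomial ℕ K, MvPolynomial.aeval x Q ≠ 0 ∧
      y * x 0 ^ N * x N + MvPolynomial.aeval (fun i : Fin N => x i) B =
        MvPolynomial.aeval x P / MvPolynomial.aeval x Q := by
    obtain ⟨P, Q, h⟩ := (mem_adjoin_range_iff K x _).mp hg
    by_cases h0 : MvPolynomial.aeval x Q = 0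
    · exact ⟨0, 1, by simp, by rw [h, h0]; simp⟩
    · exact ⟨P, Q, h0, h⟩
  set m : ℕ →₀ ℕ := Finsupp.single 0 N + Finsupp.single N 1 with hm
  set S : MvPolynomial ℕ M := MvPolynomial.monomial m ⟨y, hy⟩ +
    MvPolynomial.rename Fin.val B with hS
  have hSx : MvPolynomial.aeval x S = MvPolynomial.aeval x P / MvPolynomial.aeval x Q := by
    rw [← hPQ, hS, map_add, MvPolynomial.aeval_rename, MvPolynomial.aeval_monomial, hm,
      Finsupp.prod_add_index' (by simp) (fun _ _ _ => pow_add _ _ _)]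
    simp only [Finsupp.prod_single_index, pow_zero, pow_one, mul_assoc]
    rfl
  have hmap : ∀ p : MvPolynomial ℕ K,
      MvPolynomial.aeval x (MvPolynomial.map (algebraMap K M) p) = MvPolynomial.aeval x p := by
    intro p
    rw [MvPolynomial.aeval_map_algebraMap]
  have hmul : MvPolynomial.map (algebraMap K M) Q * S = MvPolynomial.map (algebraMap K M) P := by
    apply hx
    rw [map_mul, hmap, hmap, hSx, mul_div_cancel₀ _ hQ]
  obtain ⟨T, hT⟩ := MvPolynomial.exists_map_eq_of_mul_eq (by rintro rfl; simp at hQ) hmul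
  have hcoeff : MvPolynomial.coeff m S = ⟨y, hy⟩ := by
    rw [hS, MvPolynomial.coeff_add, MvPolynomial.coeff_monomial, if_pos rfl,
      MvPolynomial.coeff_rename_eq_zero, add_zero]
    intro d hd
    exfalso
    have h1 := DFunLike.congr_fun hd N
    rw [Finsupp.mapDomain_of_notMem_range] at h1
    · simp [hm] at h1
    · rintro ⟨i, hi⟩
      exact absurd hi i.2.ne
  refine ⟨MvPolynomial.coeff m T, ?_⟩
  rw [← hT, MvPolynomial.coeff_map] at hcoeff
  exact congrArg Subtype.val hcoeff

end

/-- Let `Φ` and `δ` satisfy `δ Φ = ρ Φ δ`, let `Ψ` be a differentially transcendental solution of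
`Φ Ψ = ρ Ψ`, and let the fixed field of `Φ` be contained in `K`. A solution `y` of
`ρ Φ y = y + b` that is differentially algebraic over `K` lies in `K`. -/
theorem mem_range_of_mul_map_eq_add {K F : Type*} [Field K] [Field F] [CharZero F] [Algebra K F]
    (δ : Derivation ℤ F F) (hδK : ∀ k : K, δ (algebraMap K F k) ∈ (algebraMap K F).range)
    (Φ : F →+* F) (hΦK : ∀ k : K, Φ (algebraMap K F k) ∈ (algebraMap K F).range)
    (hfix : ∀ x, Φ x = x → x ∈ (algebraMap K F).range)
    {ρ Ψ y b : F} (hρK : ρ ∈ (algebraMap K F).range) (hρ : ρ ≠ 0)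
    (hchain : ∀ x, δ (Φ x) = ρ * Φ (δ x)) (hΨ : Φ Ψ = ρ * Ψ)
    (hind : AlgebraicIndependent K fun i : ℕ => δ^[i] Ψ)
    (hy : ∃ M : IntermediateField K F, M.FG ∧ y ∈ M ∧ ∀ x ∈ M, δ x ∈ M)
    (hb : b ∈ (algebraMap K F).range) (hyb : ρ * Φ y = y + b) : y ∈ (algebraMap K F).range := by
  classical
  obtain ⟨M, hfg, hyM, hM⟩ := hy
  set x : ℕ → F := fun i => δ^[i] Ψ with hx
  have hsucc : ∀ i, δ (x i) = x (i + 1) := fun i => (Function.iterate_succ_apply' δ i Ψ).symm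
  set L := adjoin K (Set.range x) with hL
  have hKL : ∀ a ∈ (algebraMap K F).range, a ∈ L := by
    rintro _ ⟨k, rfl⟩
    exact L.algebraMap_mem k
  have hxL : ∀ i, x i ∈ L := fun i => subset_adjoin _ _ ⟨i, rfl⟩
  have hδL : ∀ a ∈ L, δ a ∈ L := fun a ha => by
    refine derivation_mem_of_mem_adjoin δ hδK (subset_adjoin _ _) ?_ ha
    rintro _ ⟨i, rfl⟩
    rw [hsucc]
    exact hxL _
  have hΦx : ∀ i, Φ (x i) ∈ L := by
    intro i
    induction i with
    | zero =>
      change Φ Ψ ∈ L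
      rw [hΨ]
      exact L.mul_mem (hKL _ hρK) (hxL 0)
    | succ i ih =>
      have h := L.div_mem (hδL _ ih) (hKL _ hρK)
      rwa [hchain, hsucc, mul_div_cancel_left₀ _ hρ] at h
  have hΦL : ∀ a ∈ L, Φ a ∈ L := fun a ha => by
    refine map_mem_of_mem_adjoin Φ hΦK ?_ ha
    rintro _ ⟨i, rfl⟩
    exact hΦx i
  let φ : L →+* L := (Φ.comp (algebraMap L F)).codRestrict L.toSubfield fun a => hΦL _ a.2
  have hφ : ∀ a : L, Φ (algebraMap L F a) = algebraMap L F (φ a) := fun a => rfl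
  let D : F → F := fun a => Ψ * δ a
  have hDadd : ∀ a c, D (a + c) = D a + D c := fun a c => by simp only [D, map_add, mul_add]
  have hDiter_add : ∀ i a c, D^[i] (a + c) = D^[i] a + D^[i] c := by
    intro i
    induction i with
    | zero => intro a c; rfl
    | succ i ih =>
      intro a c
      simp only [Function.iterate_succ_apply', ih, hDadd]
  have hΦD : ∀ a, Φ (D a) = D (Φ a) := fun a => by
    simp only [D, map_mul, hΨ, hchain]
    ring
  have hΦDiter : ∀ i a, Φ (D^[i] a) = D^[i] (Φ a) := by
    intro i
    induction i with
    | zero => intro a; rfl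
    | succ i ih =>
      intro a
      simp only [Function.iterate_succ_apply', ih, hΦD]
  have hDL : ∀ i, ∀ a ∈ L, D^[i] a ∈ L := by
    intro i
    induction i with
    | zero => intro a ha; exact ha
    | succ i ih =>
      intro a ha
      rw [Function.iterate_succ_apply']
      exact L.mul_mem (hxL 0) (hδL _ (ih a ha))
  have hΨb : Ψ * b ∈ L := L.mul_mem (hxL 0) (hKL _ hb)
  let u : ℕ → F := fun i => D^[i] (Ψ * y)
  have hu : ∀ i, Φ (u i) = u i + D^[i] (Ψ * b) := by
    intro i
    rw [hΦDiter, map_mul, hΨ, ← hDiter_add]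
    congr 1
    linear_combination Ψ * hyb
  have hdep : ¬ AlgebraicIndependent L u := by
    obtain ⟨S, hS⟩ := hfg
    let E : IntermediateField L F := adjoin L (S : Set F)
    have hME : ∀ a ∈ M, a ∈ E := by
      have : M ≤ E.restrictScalars K := by
        rw [← hS, adjoin_le_iff]
        exact subset_adjoin L (S : Set F)
      exact fun a ha => this ha
    have hSM : ∀ s ∈ (S : Set F), s ∈ M := fun s hs => hS ▸ subset_adjoin _ _ hs
    have hLE : ∀ a ∈ L, a ∈ E := fun a ha => E.algebraMap_mem ⟨a, ha⟩
    have hδE : ∀ a ∈ E, δ a ∈ E := fun a ha =>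
      derivation_mem_of_mem_adjoin δ (fun k : L => ⟨⟨_, hδL _ k.2⟩, rfl⟩) (subset_adjoin _ _)
        (fun s hs => hME _ (hM _ (hSM s hs))) ha
    have : Algebra.EssFiniteType L E :=
      essFiniteType_iff.mpr (fg_adjoin_of_finite S.finite_toSet)
    refine not_algebraicIndependent_of_finTrdeg (E := E) fun i => ?_
    induction i with
    | zero => exact E.mul_mem (hLE _ (hxL 0)) (hME _ hyM)
    | succ i ih =>
      change D^[i + 1] (Ψ * y) ∈ E
      rw [Function.iterate_succ_apply']
      exact E.mul_mem (hLE _ (hxL 0)) (hδE _ ih)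
  rw [algebraicIndependent_nat_iff] at hdep
  push Not at hdep
  obtain ⟨n, hn⟩ := hdep
  obtain ⟨c, hc0, hcφ, g, hg⟩ := exists_sum_mem_of_not_algebraicIndependent hφ
    (fun a ha => ⟨⟨a, hKL _ (hfix a ha)⟩, rfl⟩)
    (b := fun i : Fin n => (⟨_, hDL i _ hΨb⟩ : L)) (fun i => hu i) hn
  have hcK : ∀ i, (c i : F) ∈ (algebraMap K F).range := fun i =>
    hfix _ (by rw [← IntermediateField.algebraMap_apply, hφ, hcφ])
  have hne : (Finset.univ.filter fun i => c i ≠ 0).Nonempty := by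
    obtain ⟨i, hi⟩ := Function.ne_iff.mp hc0
    exact ⟨i, by simpa using hi⟩
  set N := (Finset.univ.filter fun i => c i ≠ 0).max' hne with hN
  have hcN : c N ≠ 0 := (Finset.mem_filter.mp (Finset.max'_mem _ hne)).2
  have hmax : ∀ i, c i ≠ 0 → i ≤ N := fun i hi => Finset.le_max' _ _ (by simpa using hi)
  set A := Algebra.adjoin M (x '' Set.Iio (N : ℕ)) with hA
  have hMA : ∀ a ∈ M, a ∈ A := fun a ha => A.algebraMap_mem ⟨a, ha⟩
  have hKM : ∀ a ∈ (algebraMap K F).range, a ∈ M := by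
    rintro _ ⟨k, rfl⟩
    exact M.algebraMap_mem k
  have huA : ∀ i < (N : ℕ), u i ∈ A := by
    intro i hi
    have h1 := iterate_sub_mem_adjoin δ hM Ψ hyM i
    have h2 : Algebra.adjoin M (x '' Set.Iio i) ≤ A :=
      Algebra.adjoin_mono (Set.image_mono fun j hj => lt_trans hj hi)
    have hxA : ∀ j < (N : ℕ), x j ∈ A := fun j hj => Algebra.subset_adjoin ⟨j, hj, rfl⟩
    have h3 := A.add_mem (h2 h1) (A.mul_mem (A.mul_mem (hMA _ hyM)
      (A.pow_mem (hxA 0 (by omega)) i)) (hxA i hi))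
    convert h3 using 1
    change u i = u i - y * Ψ ^ i * δ^[i] Ψ + y * Ψ ^ i * δ^[i] Ψ
    ring
  have hrest : (∑ i, algebraMap L F (c i) * u i) - (c N : F) * y * x 0 ^ (N : ℕ) * x N ∈ A := by
    rw [← Finset.add_sum_erase _ _ (Finset.mem_univ N)]
    have h1 := A.add_mem (A.mul_mem (hMA _ (hKM _ (hcK N)))
      (iterate_sub_mem_adjoin δ hM Ψ hyM N)) (A.sum_mem (t := Finset.univ.erase N)
      (f := fun i => algebraMap L F (c i) * u i) fun i hi => by
        by_cases h0 : c i = 0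
        · simp [h0]
        · exact A.mul_mem (hMA _ (hKM _ (hcK i)))
            (huA i (Fin.lt_def.mp (lt_of_le_of_ne (hmax i h0) (Finset.ne_of_mem_erase hi)))))
    convert h1 using 1
    change (c N : F) * u N + _ - (c N : F) * y * Ψ ^ (N : ℕ) * x N =
      (c N : F) * (u N - y * Ψ ^ (N : ℕ) * x N) + _
    ring
  have hcy := mem_range_of_leading_term_add_mem (algebraicIndependent_of_fg δ hind hfg hM)
    (M.mul_mem (hKM _ (hcK N)) hyM) hrest (by
      rw [add_sub_cancel, hg]
      exact g.2)
  obtain ⟨k, hk⟩ := hcK N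
  obtain ⟨l, hl⟩ := hcy
  refine ⟨l / k, ?_⟩
  have hcN' : (c N : F) ≠ 0 := fun h => hcN (Subtype.ext h)
  rw [map_div₀, hl, hk, mul_div_cancel_left₀ _ hcN']

end IterativeEquation

/-! ### The derivation of a field of rational functions -/

namespace IterativeEquation

open Polynomial

/-- An additive self-map of a field satisfying the Leibniz rule, as a derivation. -/
def derivationOfLeibniz {F : Type*} [Field F] (d : F → F) (hadd : ∀ f g, d (f + g) = d f + d g)
    (hmul : ∀ f g, d (f * g) = f * d g + g * d f) : Derivation ℤ F F :=
  Derivation.mk' (AddMonoidHom.mk' d hadd).toIntLinearMap hmul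

/-- The subfield on which the chain rule `δ' Φ = ρ Φ δ` holds. -/
def chainSubfield {E F : Type*} [Field E] [Field F] (δ : Derivation ℤ E E) (δ' : Derivation ℤ F F)
    (Φ : E →+* F) (ρ : F) : Subfield E where
  carrier := {f | δ' (Φ f) = ρ * Φ (δ f)}
  zero_mem' := by simp
  one_mem' := by simp
  add_mem' {f g} hf hg := by
    rw [Set.mem_ofPred_eq] at *
    simp only [map_add, hf, hg, mul_add]
  neg_mem' {f} hf := by
    rw [Set.mem_ofPred_eq] at *
    simp only [map_neg, hf, mul_neg]
  mul_mem' {f g} hf hg := by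
    rw [Set.mem_ofPred_eq] at *
    simp only [map_mul, Derivation.leibniz, hf, hg, smul_eq_mul, map_add]
    ring
  inv_mem' f hf := by
    rw [Set.mem_ofPred_eq] at *
    simp only [map_inv₀, Derivation.leibniz_inv, hf, smul_eq_mul, map_mul, map_neg, map_pow]
    ring

section

variable {L : Type*} [Field L]

lemma ratFunc_induction {P : RatFunc L → Prop} (hC : ∀ a, P (RatFunc.C a)) (hX : P RatFunc.X)
    (hadd : ∀ f g, P f → P g → P (f + g)) (hmul : ∀ f g, P f → P g → P (f * g))
    (hinv : ∀ f, P f → P f⁻¹) (f : RatFunc L) : P f := by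
  have hpoly : ∀ p : L[X], P (algebraMap L[X] (RatFunc L) p) := by
    intro p
    induction p using Polynomial.induction_on with
    | C a => rw [RatFunc.algebraMap_C]; exact hC a
    | add p q hp hq => rw [map_add]; exact hadd _ _ hp hq
    | monomial n a h =>
      rw [pow_succ, ← mul_assoc, map_mul, RatFunc.algebraMap_X]
      exact hmul _ _ h hX
  rw [← RatFunc.num_div_denom f, div_eq_mul_inv]
  exact hmul _ _ (hpoly _) (hinv _ (hpoly _))

variable (D : Derivation ℤ L L) (w : L)

lemma polyDeriv_monomial (n : ℕ) (a : L) :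
    polyDeriv D w (monomial n a) = monomial n (D a) + C w * derivative (monomial n a) := by
  rw [polyDeriv, sum_monomial_index]
  simp

lemma polyDeriv_add (p q : L[X]) : polyDeriv D w (p + q) = polyDeriv D w p + polyDeriv D w q := by
  rw [polyDeriv, polyDeriv, polyDeriv, sum_add_index _ _ _ (by simp) (by simp), derivative_add]
  ring

lemma polyDeriv_mul (p q : L[X]) :
    polyDeriv D w (p * q) = p * polyDeriv D w q + q * polyDeriv D w p := by
  induction p using Polynomial.induction_on' with
  | add p₁ p₂ h₁ h₂ => rw [add_mul, polyDeriv_add, h₁, h₂, polyDeriv_add]; ring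
  | monomial n a =>
    induction q using Polynomial.induction_on' with
    | add q₁ q₂ h₁ h₂ => rw [mul_add, polyDeriv_add, h₁, h₂, polyDeriv_add]; ring
    | monomial m b =>
      rw [monomial_mul_monomial, polyDeriv_monomial, polyDeriv_monomial, polyDeriv_monomial,
        ← monomial_mul_monomial, derivative_mul, Derivation.leibniz, map_add, smul_eq_mul,
        smul_eq_mul, ← monomial_mul_monomial, add_comm n m, ← monomial_mul_monomial]
      ring

@[simp] lemma polyDeriv_C (a : L) : polyDeriv D w (C a) = C (D a) := by
  rw [← monomial_zero_left, polyDeriv_monomial]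
  simp

@[simp] lemma polyDeriv_X : polyDeriv D w (X : L[X]) = C w := by
  rw [← monomial_one_one_eq_X, polyDeriv_monomial]
  simp

lemma polyDeriv_quotient {p q n d : L[X]} (h : p * d = n * q) :
    (polyDeriv D w n * d - n * polyDeriv D w d) * q ^ 2 =
      (polyDeriv D w p * q - p * polyDeriv D w q) * d ^ 2 := by
  have h2 := congrArg (polyDeriv D w) h
  rw [polyDeriv_mul, polyDeriv_mul] at h2
  linear_combination (-d * q) * h2 +
    (polyDeriv D w d * q + d * polyDeriv D w q) * h

lemma ratFuncDeriv_div (p q : L[X]) (hq : q ≠ 0) :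
    ratFuncDeriv D w (algebraMap L[X] (RatFunc L) p / algebraMap L[X] (RatFunc L) q) =
      (algebraMap L[X] (RatFunc L) (polyDeriv D w p) * algebraMap L[X] (RatFunc L) q -
        algebraMap L[X] (RatFunc L) p * algebraMap L[X] (RatFunc L) (polyDeriv D w q)) /
        algebraMap L[X] (RatFunc L) q ^ 2 := by
  generalize hf : algebraMap L[X] (RatFunc L) p / algebraMap L[X] (RatFunc L) q = f
  have hq' : algebraMap L[X] (RatFunc L) q ≠ 0 := RatFunc.algebraMap_ne_zero hq
  have hd' : algebraMap L[X] (RatFunc L) f.denom ≠ 0 := RatFunc.algebraMap_ne_zero f.denom_ne_zero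
  have hpq : p * f.denom = f.num * q := by
    have h1 := hf.trans (RatFunc.num_div_denom f).symm
    rw [div_eq_div_iff hq' hd', ← map_mul, ← map_mul] at h1
    exact RatFunc.algebraMap_injective L h1
  have h3 := congrArg (algebraMap L[X] (RatFunc L)) (polyDeriv_quotient D w hpq)
  rw [ratFuncDeriv, map_pow, div_eq_div_iff (pow_ne_zero 2 hd') (pow_ne_zero 2 hq'), ← map_sub]
  simpa only [map_mul, map_sub, map_pow] using h3

lemma ratFuncDeriv_add (f g : RatFunc L) :
    ratFuncDeriv D w (f + g) = ratFuncDeriv D w f + ratFuncDeriv D w g := by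
  induction f using RatFunc.induction_on with
  | _ p q hq =>
  induction g using RatFunc.induction_on with
  | _ p' q' hq' =>
  have h1 : algebraMap L[X] (RatFunc L) q ≠ 0 := RatFunc.algebraMap_ne_zero hq
  have h2 : algebraMap L[X] (RatFunc L) q' ≠ 0 := RatFunc.algebraMap_ne_zero hq'
  rw [div_add_div _ _ h1 h2, ← map_mul, ← map_mul, ← map_mul, ← map_add,
    ratFuncDeriv_div D w _ _ (mul_ne_zero hq hq'), ratFuncDeriv_div D w _ _ hq,
    ratFuncDeriv_div D w _ _ hq', polyDeriv_add, polyDeriv_mul, polyDeriv_mul, polyDeriv_mul]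
  simp only [map_mul, map_add]
  field_simp
  ring

lemma ratFuncDeriv_mul (f g : RatFunc L) :
    ratFuncDeriv D w (f * g) = f * ratFuncDeriv D w g + g * ratFuncDeriv D w f := by
  induction f using RatFunc.induction_on with
  | _ p q hq =>
  induction g using RatFunc.induction_on with
  | _ p' q' hq' =>
  have h1 : algebraMap L[X] (RatFunc L) q ≠ 0 := RatFunc.algebraMap_ne_zero hq
  have h2 : algebraMap L[X] (RatFunc L) q' ≠ 0 := RatFunc.algebraMap_ne_zero hq'
  rw [div_mul_div_comm, ← map_mul, ← map_mul,
    ratFuncDeriv_div D w _ _ (mul_ne_zero hq hq'), ratFuncDeriv_div D w _ _ hq,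
    ratFuncDeriv_div D w _ _ hq', polyDeriv_mul, polyDeriv_mul]
  simp only [map_mul, map_add]
  field_simp
  ring

/-- `ratFuncDeriv` as a derivation. -/
noncomputable def ratFuncDerivation :=
  derivationOfLeibniz (ratFuncDeriv D w) (ratFuncDeriv_add D w) (ratFuncDeriv_mul D w)

@[simp] lemma coe_ratFuncDerivation : ⇑(ratFuncDerivation D w) = ratFuncDeriv D w := rfl

@[simp] lemma ratFuncDerivation_algebraMap (p : L[X]) :
    ratFuncDerivation D w (algebraMap L[X] (RatFunc L) p) =
      algebraMap L[X] (RatFunc L) (polyDeriv D w p) := by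
  have h := ratFuncDeriv_div D w p 1 one_ne_zero
  have h1 : polyDeriv D w (1 : L[X]) = 0 := by
    rw [← C_1, polyDeriv_C]
    simp
  simpa [h1] using h

@[simp] lemma ratFuncDerivation_C (a : L) :
    ratFuncDerivation D w (RatFunc.C a) = RatFunc.C (D a) := by
  rw [← RatFunc.algebraMap_C, ratFuncDerivation_algebraMap, polyDeriv_C, RatFunc.algebraMap_C]

@[simp] lemma ratFuncDerivation_X :
    ratFuncDerivation D w (RatFunc.X : RatFunc L) = RatFunc.C w := by
  rw [← RatFunc.algebraMap_X, ratFuncDerivation_algebraMap, polyDeriv_X, RatFunc.algebraMap_C]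

lemma ringHom_ratFunc_mem {F : Type*} [Field F] (Φ : RatFunc L →+* F) (E : Subfield F)
    (hC : ∀ a, Φ (RatFunc.C a) ∈ E) (hX : Φ RatFunc.X ∈ E) (f : RatFunc L) : Φ f ∈ E := by
  induction f using ratFunc_induction with
  | hC a => exact hC a
  | hX => exact hX
  | hadd f g hf hg => rw [map_add]; exact E.add_mem hf hg
  | hmul f g hf hg => rw [map_mul]; exact E.mul_mem hf hg
  | hinv f hf => rw [map_inv₀]; exact E.inv_mem hf

/-- A chain rule for the derivation of `L(T)` that extends `D` and sends `T` to `w`: it suffices to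
check it on `L` and on `T`. -/
lemma ratFuncDerivation_chain {F : Type*} [Field F] (δ : Derivation ℤ F F) (Φ : RatFunc L →+* F)
    (ρ : F) (hC : ∀ a, δ (Φ (RatFunc.C a)) = ρ * Φ (RatFunc.C (D a)))
    (hX : δ (Φ RatFunc.X) = ρ * Φ (RatFunc.C w)) (f : RatFunc L) :
    δ (Φ f) = ρ * Φ (ratFuncDerivation D w f) := by
  refine ringHom_ratFunc_mem (RingHom.id _) (chainSubfield (ratFuncDerivation D w) δ Φ ρ)
    (fun a => ?_) ?_ f
  · change δ (Φ (RatFunc.C a)) = ρ * Φ (ratFuncDerivation D w (RatFunc.C a))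
    rw [hC, ratFuncDerivation_C]
  · change δ (Φ RatFunc.X) = ρ * Φ (ratFuncDerivation D w RatFunc.X)
    rw [hX, ratFuncDerivation_X]

variable {φ : L →+* L} {c u : L} (hc : c ≠ 0)

lemma ratFuncHom_algebraMap (p : L[X]) :
    ratFuncHom φ c u hc (algebraMap L[X] (RatFunc L) p) =
      algebraMap L[X] (RatFunc L) (p.eval₂ (C.comp φ) (C c * X + C u)) := by
  have h := RatFunc.map_apply_div (eval₂RingHom (C.comp φ) (C c * X + C u))
    (nonZeroDivisors_le_comap_nonZeroDivisors_of_injective _ (eval₂_linear_injective φ c u hc)) p 1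
  simpa [ratFuncHom, RatFunc.coe_mapRingHom_eq_coe_map] using h

@[simp] lemma ratFuncHom_C (a : L) : ratFuncHom φ c u hc (RatFunc.C a) = RatFunc.C (φ a) := by
  rw [← RatFunc.algebraMap_C, ratFuncHom_algebraMap]
  simp

@[simp] lemma ratFuncHom_X :
    ratFuncHom φ c u hc RatFunc.X = RatFunc.C c * RatFunc.X + RatFunc.C u := by
  rw [← RatFunc.algebraMap_X, ratFuncHom_algebraMap]
  simp

end

end IterativeEquation

/-! ### The derivation of `ℂ((t))` -/

namespace IterativeEquation

open HahnSeries

lemma ddt_coeff (f : ℂ⸨X⸩) (n : ℤ) : (ddt f).coeff n = (n + 1) * f.coeff (n + 1) := by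
  rw [ddt, LaurentSeries.derivative_apply, LaurentSeries.hasseDeriv_coeff]
  simp

lemma ddt_add (f g : ℂ⸨X⸩) : ddt (f + g) = ddt f + ddt g := map_add _ f g

lemma ddt_ofPowerSeries (p : ℂ⟦X⟧) :
    ddt (ofPowerSeries ℤ ℂ p) = ofPowerSeries ℤ ℂ (PowerSeries.derivative ℂ p) := by
  ext n
  rw [ddt_coeff, PowerSeries.coeff_coe, PowerSeries.coeff_coe]
  rcases lt_or_ge n 0 with hn | hn
  · rw [if_pos hn]
    rcases lt_or_ge (n + 1) 0 with h | h
    · rw [if_pos h, mul_zero]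
    · obtain rfl : n = -1 := by omega
      simp
  · rw [if_neg (by omega), if_neg (by omega), PowerSeries.coeff_derivative]
    lift n to ℕ using hn
    norm_cast
    rw [mul_comm]

lemma ddt_single_mul (n : ℤ) (f : ℂ⸨X⸩) :
    ddt (single n 1 * f) = single (n - 1) (n : ℂ) * f + single n 1 * ddt f := by
  ext k
  have h1 := coeff_single_mul_add (r := (1 : ℂ)) (x := f) (a := k + 1 - n) (b := n)
  have h2 := coeff_single_mul_add (r := (n : ℂ)) (x := f) (a := k + 1 - n) (b := n - 1)
  have h3 := coeff_single_mul_add (r := (1 : ℂ)) (x := ddt f) (a := k - n) (b := n)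
  rw [show k + 1 - n + n = k + 1 by ring] at h1
  rw [show k + 1 - n + (n - 1) = k by ring] at h2
  rw [show k - n + n = k by ring] at h3
  rw [ddt_coeff, coeff_add, h1, h2, h3, ddt_coeff, show k - n + 1 = k + 1 - n by ring]
  push_cast
  ring

lemma exists_single_mul (f : ℂ⸨X⸩) :
    ∃ (n : ℤ) (p : ℂ⟦X⟧), f = single n 1 * ofPowerSeries ℤ ℂ p :=
  ⟨f.order, f.powerSeriesPart, (LaurentSeries.single_order_mul_powerSeriesPart f).symm⟩

lemma ddt_mul (f g : ℂ⸨X⸩) : ddt (f * g) = f * ddt g + g * ddt f := by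
  obtain ⟨n, p, rfl⟩ := exists_single_mul f
  obtain ⟨m, q, rfl⟩ := exists_single_mul g
  have h : ∀ k : ℤ, (single (k - 1) (k : ℂ) : ℂ⸨X⸩) = C (k : ℂ) * single (-1) 1 * single k 1 := by
    intro k
    rw [C_apply, single_mul_single, single_mul_single, mul_one, mul_one,
      show (0 : ℤ) + -1 + k = k - 1 by ring]
  have e : single n 1 * ofPowerSeries ℤ ℂ p * (single m 1 * ofPowerSeries ℤ ℂ q) =
      single (n + m) 1 * ofPowerSeries ℤ ℂ (p * q) := by
    rw [map_mul, show (single (n + m) (1 : ℂ) : ℂ⸨X⸩) = single n 1 * single m 1 by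
      rw [single_mul_single, one_mul]]
    ring
  rw [e, ddt_single_mul, ddt_single_mul, ddt_single_mul, ddt_ofPowerSeries, ddt_ofPowerSeries,
    ddt_ofPowerSeries, Derivation.leibniz, h, h, h,
    show (single (n + m) (1 : ℂ) : ℂ⸨X⸩) = single n 1 * single m 1 by
      rw [single_mul_single, one_mul]]
  push_cast
  simp only [smul_eq_mul, map_mul, map_add]
  ring

/-- `d/dt` as a derivation of `ℂ((t))`. -/
noncomputable def ddtDerivation := derivationOfLeibniz ddt ddt_add ddt_mul

@[simp] lemma coe_ddtDerivation : ⇑ddtDerivation = ddt := rfl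

@[simp] lemma ddt_C (c : ℂ) : ddt (C c) = 0 := by
  rw [← PowerSeries.coe_C, ddt_ofPowerSeries]
  simp

lemma eq_C_of_ddt_eq_zero {f : ℂ⸨X⸩} (hf : ddt f = 0) : f = C (f.coeff 0) := by
  ext n
  by_cases h : n = 0
  · subst h
    simp [C_apply]
  · have h1 := congrArg (fun g : ℂ⸨X⸩ => g.coeff (n - 1)) hf
    simp only [ddt_coeff, coeff_zero, mul_eq_zero, sub_add_cancel] at h1
    rw [C_apply, coeff_single_of_ne h]
    refine h1.resolve_left ?_
    push_cast
    rw [sub_add_cancel]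
    exact_mod_cast h

/-! ### The subfield `ℂ(t)` of `ℂ((t))` -/

@[simp] lemma expansion_C (c : ℂ) : expansion (RatFunc.C c) = C c := by
  rw [expansion, ← RatFunc.algebraMap_C]
  have := RatFunc.coe_coe (Polynomial.C c)
  simp only [Polynomial.coe_C, PowerSeries.coe_C] at this
  exact this.symm

lemma expansion_X : expansion RatFunc.X = ofPowerSeries ℤ ℂ PowerSeries.X := by
  rw [PowerSeries.coe_X]
  exact RatFunc.coe_X

/-- `d/dt` on `ℂ(t)`. -/
noncomputable def ratDeriv := ratFuncDerivation (0 : Derivation ℤ ℂ ℂ) 1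

lemma ddt_expansion (f : RatFunc ℂ) : ddt (expansion f) = expansion (ratDeriv f) := by
  have h := ratFuncDerivation_chain (0 : Derivation ℤ ℂ ℂ) 1 ddtDerivation expansion 1
    (fun a => by simp [-C_apply]) (by
      rw [expansion_X, coe_ddtDerivation, ddt_ofPowerSeries]
      simp) f
  rw [one_mul] at h
  exact h

/-! ### The endomorphism `Φ_R` -/

section

variable {R : ℂ⟦X⟧} (h0 : PowerSeries.constantCoeff R = 0) (hR : R ≠ 0)

lemma Phi_ofPowerSeries (p : ℂ⟦X⟧) :
    Phi R h0 hR (ofPowerSeries ℤ ℂ p) = ofPowerSeries ℤ ℂ (PowerSeries.subst R p) := by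
  have h := IsLocalization.Away.lift_eq (S := ℂ⸨X⸩) (PowerSeries.X : ℂ⟦X⟧)
    (isUnit_subst_X R h0 hR) p
  rw [LaurentSeries.coe_algebraMap] at h
  rw [Phi, h, ← PowerSeries.coe_substAlgHom (PowerSeries.HasSubst.of_constantCoeff_zero' h0)]
  rfl

@[simp] lemma Phi_C (c : ℂ) : Phi R h0 hR (C c) = C c := by
  rw [← PowerSeries.coe_C, Phi_ofPowerSeries, PowerSeries.subst_C]
  rfl

lemma mem_of_ofPowerSeries_mem (E : Subfield ℂ⸨X⸩) (hE : ∀ p, ofPowerSeries ℤ ℂ p ∈ E)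
    (f : ℂ⸨X⸩) : f ∈ E := by
  obtain ⟨p, q, -, rfl⟩ := IsFractionRing.div_surjective (A := ℂ⟦X⟧) f
  exact E.div_mem (hE p) (hE q)

lemma ddt_Phi (f : ℂ⸨X⸩) : ddt (Phi R h0 hR f) =
    ofPowerSeries ℤ ℂ (PowerSeries.derivative ℂ R) * Phi R h0 hR (ddt f) := by
  refine mem_of_ofPowerSeries_mem (chainSubfield ddtDerivation ddtDerivation (Phi R h0 hR)
    (ofPowerSeries ℤ ℂ (PowerSeries.derivative ℂ R))) (fun p => ?_) f
  change ddt (Phi R h0 hR _) = _ * Phi R h0 hR (ddt _)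
  rw [Phi_ofPowerSeries, ddt_ofPowerSeries, ddt_ofPowerSeries, Phi_ofPowerSeries,
    PowerSeries.derivative_subst (PowerSeries.HasSubst.of_constantCoeff_zero' h0), map_mul,
    mul_comm]

lemma Phi_expansion_mem (hrat : ofPowerSeries ℤ ℂ R ∈ expansion.range) (f : RatFunc ℂ) :
    Phi R h0 hR (expansion f) ∈ expansion.range := by
  refine ringHom_ratFunc_mem ((Phi R h0 hR).comp expansion) expansion.fieldRange (fun a => ?_) ?_ f
  · rw [RingHom.comp_apply, expansion_C, Phi_C, ← expansion_C]
    exact ⟨_, rfl⟩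
  · rw [RingHom.comp_apply, expansion_X, Phi_ofPowerSeries,
      PowerSeries.subst_X (PowerSeries.HasSubst.of_constantCoeff_zero' h0)]
    exact hrat

lemma derivative_ne_zero_of_constantCoeff_eq_zero (h0 : PowerSeries.constantCoeff R = 0)
    (hR : R ≠ 0) : PowerSeries.derivative ℂ R ≠ 0 := by
  intro h
  apply hR
  apply PowerSeries.derivative.ext (R := ℂ)
  · rw [h, map_zero]
  · rw [h0, map_zero]

lemma derivative_mem_range (hrat : ofPowerSeries ℤ ℂ R ∈ expansion.range) :
    ofPowerSeries ℤ ℂ (PowerSeries.derivative ℂ R) ∈ expansion.range := by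
  obtain ⟨r, hr⟩ := hrat
  rw [← ddt_ofPowerSeries, ← hr, ddt_expansion]
  exact ⟨_, rfl⟩

end

end IterativeEquation

/-! ### Power series fixed by a substitution -/

namespace IterativeEquation

open PowerSeries

section

variable {R : ℂ⟦X⟧}

lemma hasSubst_of_constantCoeff (h0 : constantCoeff R = 0) : HasSubst R :=
  HasSubst.of_constantCoeff_zero' h0

lemma constantCoeff_subst_of_constantCoeff (h0 : constantCoeff R = 0) (p : ℂ⟦X⟧) :
    constantCoeff (subst R p) = constantCoeff p := by
  have hs := hasSubst_of_constantCoeff h0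
  obtain ⟨q, hq⟩ : X ∣ p - C (constantCoeff p) := by
    rw [X_dvd_iff]
    simp
  have h1 : p = C (constantCoeff p) + X * q := by rw [← hq]; ring
  conv_lhs => rw [h1, subst_add hs, subst_mul hs, subst_X hs, subst_C]
  rw [map_add, map_mul, h0, zero_mul, add_zero]
  exact constantCoeff_C _

lemma coeff_one_X_mul (p : ℂ⟦X⟧) : coeff 1 (X * p) = coeff 0 p := coeff_succ_X_mul 0 p

lemma subst_C_self (R : ℂ⟦X⟧) (c : ℂ) : subst R (C c : ℂ⟦X⟧) = C c := subst_C c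

lemma X_pow_dvd_subst {d : ℕ} (h0 : constantCoeff R = 0) (hd : X ^ d ∣ R) {p : ℂ⟦X⟧} {n : ℕ}
    (hp : X ^ n ∣ p) : X ^ (d * n) ∣ subst R p := by
  have hs := hasSubst_of_constantCoeff h0
  obtain ⟨q, rfl⟩ := hp
  rw [subst_mul hs, subst_pow hs, subst_X hs, pow_mul]
  exact (pow_dvd_pow_of_dvd hd n).mul_right _

/-- A semi-invariant series for a substitution that is tangent to zero is constant. -/
lemma eq_C_of_subst_eq_of_X_sq_dvd (h0 : constantCoeff R = 0) (hd : X ^ 2 ∣ R) {p : ℂ⟦X⟧} {c : ℂ}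
    (hp0 : p ≠ 0) (hc : c ≠ 0) (hp : subst R p = C c * p) :
    c = 1 ∧ p = C (constantCoeff p) := by
  have hs := hasSubst_of_constantCoeff h0
  have key : ∀ (q : ℂ⟦X⟧) (c : ℂ), q ≠ 0 → c ≠ 0 → subst R q = C c * q → constantCoeff q ≠ 0 := by
    intro q c hq0 hc hq h
    have hn := coeff_order hq0
    have hdvd := X_pow_dvd_subst h0 hd (X_pow_order_dvd (φ := q))
    have hpos : q.order.toNat ≠ 0 := fun h1 => by
      rw [h1, coeff_zero_eq_constantCoeff_apply] at hn
      exact hn h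
    rw [hq, X_pow_dvd_iff] at hdvd
    have := hdvd q.order.toNat (by omega)
    rw [coeff_C_mul, mul_eq_zero] at this
    exact this.elim hc hn
  have hpc := key p c hp0 hc hp
  have hc1 : c = 1 := by
    have h := congrArg constantCoeff hp
    rw [constantCoeff_subst_of_constantCoeff h0, map_mul, constantCoeff_C] at h
    exact mul_right_cancel₀ hpc (by rw [one_mul]; exact h.symm)
  refine ⟨hc1, ?_⟩
  by_contra hne
  refine key (p - C (constantCoeff p)) 1 (sub_ne_zero.mpr hne) one_ne_zero ?_ (by simp)
  rw [subst_sub hs, hp, hc1, subst_C_self]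
  simp

lemma X_pow_dvd_subst_sub (h0 : constantCoeff R = 0) {k : ℕ} (hk : X ^ k ∣ R - X) (p : ℂ⟦X⟧) :
    X ^ k ∣ subst R p - p := by
  have hs := hasSubst_of_constantCoeff h0
  have hpoly : ∀ q : Polynomial ℂ, X ^ k ∣ subst R (q : ℂ⟦X⟧) - (q : ℂ⟦X⟧) := by
    intro q
    induction q using Polynomial.induction_on with
    | C a =>
      rw [Polynomial.coe_C, subst_C_self, sub_self]
      exact dvd_zero _
    | add p q hp hq =>
      rw [Polynomial.coe_add, subst_add hs, add_sub_add_comm]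
      exact dvd_add hp hq
    | monomial n a h =>
      rw [pow_succ, ← mul_assoc, Polynomial.coe_mul, subst_mul hs, Polynomial.coe_X, subst_X hs]
      have e : ∀ A B : ℂ⟦X⟧, A * R - B * X = (A - B) * R + B * (R - X) := fun A B => by ring
      rw [e]
      exact dvd_add (h.mul_right _) (hk.mul_left _)
  have hR : X ^ 1 ∣ R := by rw [pow_one, X_dvd_iff, h0]
  rw [eq_X_pow_mul_shift_add_trunc k p, subst_add hs, add_sub_add_comm]
  refine dvd_add (dvd_sub ?_ (dvd_mul_right _ _)) (hpoly _)
  have := X_pow_dvd_subst h0 hR (dvd_mul_right (X ^ k) (mk fun i => coeff (i + k) p))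
  rwa [one_mul] at this

/-- A substitution tangent to the identity that fixes a nonconstant series is the identity. -/
lemma eq_X_of_subst_eq_self {S : ℂ⟦X⟧} (h0 : constantCoeff S = 0) (h1 : coeff 1 S = 1)
    {q : ℂ⟦X⟧} (hq0 : q ≠ 0) (hqc : constantCoeff q = 0) (hq : subst S q = q) : S = X := by
  have hs := hasSubst_of_constantCoeff h0
  by_contra hne
  obtain ⟨s, hsS⟩ : X ∣ S := X_dvd_iff.mpr h0
  have hs1 : constantCoeff s = 1 := by
    rw [← h1, hsS, coeff_one_X_mul, coeff_zero_eq_constantCoeff_apply]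
  have he0 : s - 1 ≠ 0 := fun h => hne (by rw [hsS, sub_eq_zero.mp h, mul_one])
  set j := (s - 1).order.toNat with hj
  have hjdvd : X ^ (j + 1) ∣ S - X := by
    rw [hsS, show X * s - X = (s - 1) * X by ring, pow_succ]
    exact mul_dvd_mul_right X_pow_order_dvd _
  set m := q.order.toNat with hm
  set u := divXPowOrder q with hu
  have hqu : X ^ m * u = q := X_pow_order_mul_divXPowOrder
  have hu0 : IsUnit u := by
    rw [isUnit_iff_constantCoeff, isUnit_iff_ne_zero]
    exact fun h => hq0 (constantCoeff_divXPowOrder_eq_zero_iff.mp h)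
  have hm0 : m ≠ 0 := by
    intro h
    have := coeff_order hq0
    rw [← hm, h, coeff_zero_eq_constantCoeff_apply] at this
    exact this hqc
  have hsu : s ^ m * subst S u = u := by
    have h := hq
    rw [← hqu, subst_mul hs, subst_pow hs, subst_X hs] at h
    nth_rewrite 1 [hsS] at h
    rw [mul_pow, mul_assoc] at h
    exact mul_left_cancel₀ (pow_ne_zero m X_ne_zero) h
  have h2 : X ^ (j + 1) ∣ (s ^ m - 1) * u := by
    have h3 : (s ^ m - 1) * u = - (s ^ m * (subst S u - u)) := by
      linear_combination hsu
    rw [h3]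
    exact ((X_pow_dvd_subst_sub h0 hjdvd u).mul_left _).neg_right
  rw [hu0.dvd_mul_right] at h2
  have hgeom : s ^ m - 1 = (s - 1) * ∑ i ∈ Finset.range m, s ^ i := by
    rw [mul_comm, geom_sum_mul]
  have hunit : IsUnit (∑ i ∈ Finset.range m, s ^ i) := by
    rw [isUnit_iff_constantCoeff, isUnit_iff_ne_zero, map_sum]
    simp [hs1, hm0]
  rw [hgeom, hunit.dvd_mul_right, X_pow_dvd_iff] at h2
  exact coeff_order he0 (h2 j (Nat.lt_succ_self j))

lemma constantCoeff_iter (h0 : constantCoeff R = 0) (n : ℕ) : constantCoeff (iter R n) = 0 := by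
  induction n with
  | zero => exact constantCoeff_X
  | succ n ih => rw [iter, constantCoeff_subst_of_constantCoeff h0, ih]

lemma coeff_one_subst (h0 : constantCoeff R = 0) {p : ℂ⟦X⟧} (hp : constantCoeff p = 0) :
    coeff 1 (subst R p) = coeff 1 p * coeff 1 R := by
  have hs := hasSubst_of_constantCoeff h0
  obtain ⟨q, rfl⟩ : X ∣ p := X_dvd_iff.mpr hp
  obtain ⟨r, hr⟩ : X ∣ R := X_dvd_iff.mpr h0
  have h : ∀ w, coeff 1 (R * w) = coeff 1 R * constantCoeff w := fun w => by
    rw [hr, mul_assoc, coeff_one_X_mul, coeff_one_X_mul]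
    simp
  rw [subst_mul hs, subst_X hs, h, constantCoeff_subst_of_constantCoeff h0, coeff_one_X_mul,
    coeff_zero_eq_constantCoeff_apply, mul_comm]

lemma coeff_one_iter (h0 : constantCoeff R = 0) (n : ℕ) :
    coeff 1 (iter R n) = coeff 1 R ^ n := by
  induction n with
  | zero => simp [iter]
  | succ n ih => rw [iter, coeff_one_subst h0 (constantCoeff_iter h0 n), ih, pow_succ]

lemma subst_iter_eq_self (h0 : constantCoeff R = 0) {q : ℂ⟦X⟧} (hq : subst R q = q) (n : ℕ) :
    subst (iter R n) q = q := by
  induction n with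
  | zero => exact X_subst q
  | succ n ih =>
    rw [iter, ← subst_comp_subst_apply (hasSubst_of_constantCoeff (constantCoeff_iter h0 n))
      (hasSubst_of_constantCoeff h0), ih, hq]

/-- If no iterate of `R` is the identity and `R'(0) ≠ 0`, the series fixed by `R` are constant. -/
lemma eq_C_of_subst_eq_self (h0 : constantCoeff R = 0)
    (hiter : ∀ n, 0 < n → iter R n ≠ X) {p : ℂ⟦X⟧} (hp : subst R p = p) :
    p = C (constantCoeff p) := by
  have hs := hasSubst_of_constantCoeff h0
  by_contra hne
  set q := p - C (constantCoeff p) with hqdef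
  have hq0 : q ≠ 0 := sub_ne_zero.mpr hne
  have hqc : constantCoeff q = 0 := by simp [hqdef]
  have hq : subst R q = q := by rw [hqdef, subst_sub hs, hp, subst_C_self]
  have hm := coeff_order hq0
  set m := q.order.toNat with hmdef
  have hm0 : 0 < m := by
    rw [Nat.pos_iff_ne_zero]
    intro h
    rw [h, coeff_zero_eq_constantCoeff_apply] at hm
    exact hm hqc
  have hroot : coeff 1 R ^ m = 1 := by
    obtain ⟨r, hr⟩ : X ∣ R := X_dvd_iff.mpr h0
    set u := divXPowOrder q with hu
    have hqu : X ^ m * u = q := X_pow_order_mul_divXPowOrder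
    have hu0 : constantCoeff u ≠ 0 :=
      fun h => hq0 (constantCoeff_divXPowOrder_eq_zero_iff.mp h)
    have h := hq
    rw [← hqu, subst_mul hs, subst_pow hs, subst_X hs] at h
    nth_rewrite 1 [hr] at h
    rw [mul_pow, mul_assoc] at h
    have h2 := congrArg constantCoeff (mul_left_cancel₀ (pow_ne_zero m X_ne_zero) h)
    rw [map_mul, map_pow, constantCoeff_subst_of_constantCoeff h0] at h2
    have h3 : coeff 1 R = constantCoeff r := by
      rw [hr, coeff_one_X_mul, coeff_zero_eq_constantCoeff_apply]
    rw [h3]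
    exact mul_right_cancel₀ hu0 (by rw [h2, one_mul])
  exact hiter m hm0 (eq_X_of_subst_eq_self (constantCoeff_iter h0 m)
    (by rw [coeff_one_iter h0, hroot]) hq0 hqc (subst_iter_eq_self h0 hq m))

end

/-! ### The fixed field of `Φ_R` in `ℂ((t))` -/

section

variable {R : ℂ⟦X⟧} (h0 : constantCoeff R = 0) (hR : R ≠ 0)

lemma exists_ofPowerSeries_or_inv (f : ℂ⸨X⸩) :
    ∃ p : ℂ⟦X⟧, f = HahnSeries.ofPowerSeries ℤ ℂ p ∨ f⁻¹ = HahnSeries.ofPowerSeries ℤ ℂ p := by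
  have hN : ∀ n : ℕ, (HahnSeries.single (n : ℤ) (1 : ℂ) : ℂ⸨X⸩) =
      HahnSeries.ofPowerSeries ℤ ℂ (X ^ n) := fun n => by
    rw [HahnSeries.ofPowerSeries_X_pow]
  rcases le_or_gt 0 f.order with h | h
  · obtain ⟨n, hn⟩ := Int.eq_ofNat_of_zero_le h
    refine ⟨X ^ n * f.powerSeriesPart, Or.inl ?_⟩
    rw [map_mul, ← hN, ← hn, LaurentSeries.single_order_mul_powerSeriesPart]
  · by_cases hf : f = 0
    · simp [hf] at h
    obtain ⟨n, hn⟩ := Int.eq_ofNat_of_zero_le (show 0 ≤ -f.order by omega)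
    have hu : IsUnit f.powerSeriesPart := by
      rw [isUnit_iff_constantCoeff, isUnit_iff_ne_zero, ← coeff_zero_eq_constantCoeff_apply,
        LaurentSeries.powerSeriesPart_coeff]
      simpa [HahnSeries.coeff_order_eq_zero] using hf
    obtain ⟨v, hv⟩ := hu
    refine ⟨X ^ n * (↑v⁻¹ : ℂ⟦X⟧), Or.inr ?_⟩
    rw [map_mul, ← hN, ← hn]
    symm
    apply eq_inv_of_mul_eq_one_left
    nth_rewrite 2 [← LaurentSeries.single_order_mul_powerSeriesPart f]
    rw [← hv, mul_mul_mul_comm, HahnSeries.single_mul_single, ← map_mul, Units.inv_mul, map_one,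
      mul_one, neg_add_cancel, mul_one]
    rfl

lemma Phi_semiinvariant_eq_C (hd : X ^ 2 ∣ R) {f : ℂ⸨X⸩} {c : ℂ} (hf0 : f ≠ 0) (hc : c ≠ 0)
    (hf : Phi R h0 hR f = HahnSeries.C c * f) : c = 1 ∧ ∃ a, f = HahnSeries.C a := by
  have key : ∀ (p : ℂ⟦X⟧) (c : ℂ), c ≠ 0 → p ≠ 0 →
      Phi R h0 hR (HahnSeries.ofPowerSeries ℤ ℂ p) =
        HahnSeries.C c * HahnSeries.ofPowerSeries ℤ ℂ p → c = 1 ∧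
      HahnSeries.ofPowerSeries ℤ ℂ p = HahnSeries.C (constantCoeff p) := by
    intro p c hc hp0 hp
    rw [Phi_ofPowerSeries, ← coe_C, ← map_mul] at hp
    obtain ⟨h1, h2⟩ := eq_C_of_subst_eq_of_X_sq_dvd h0 hd hp0 hc
      (HahnSeries.ofPowerSeries_injective hp)
    exact ⟨h1, by rw [← coe_C, ← h2]⟩
  obtain ⟨p, hp | hp⟩ := exists_ofPowerSeries_or_inv f
  · subst hp
    obtain ⟨h1, h2⟩ := key p c hc (by rintro rfl; simp at hf0) hf
    exact ⟨h1, _, h2⟩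
  · have h3 : Phi R h0 hR f⁻¹ = HahnSeries.C c⁻¹ * f⁻¹ := by
      rw [map_inv₀, hf, mul_inv, map_inv₀]
    have hf0' := inv_ne_zero hf0
    rw [hp] at h3 hf0'
    obtain ⟨h1, h2⟩ := key p c⁻¹ (inv_ne_zero hc) (by rintro rfl; simp at hf0') h3
    refine ⟨inv_eq_one.mp h1, (constantCoeff p)⁻¹, ?_⟩
    rw [map_inv₀, ← h2, ← hp, inv_inv]

lemma Phi_fixed_eq_C (hiter : ∀ n, 0 < n → iter R n ≠ X) {f : ℂ⸨X⸩}
    (hf : Phi R h0 hR f = f) : ∃ a, f = HahnSeries.C a := by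
  have key : ∀ p : ℂ⟦X⟧, Phi R h0 hR (HahnSeries.ofPowerSeries ℤ ℂ p) =
      HahnSeries.ofPowerSeries ℤ ℂ p →
      HahnSeries.ofPowerSeries ℤ ℂ p = HahnSeries.C (constantCoeff p) := by
    intro p hp
    rw [Phi_ofPowerSeries] at hp
    have h2 := eq_C_of_subst_eq_self h0 hiter (HahnSeries.ofPowerSeries_injective hp)
    rw [← coe_C, ← h2]
  obtain ⟨p, hp | hp⟩ := exists_ofPowerSeries_or_inv f
  · subst hp
    exact ⟨_, key p hf⟩
  · have h3 : Phi R h0 hR f⁻¹ = f⁻¹ := by rw [map_inv₀, hf]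
    rw [hp] at h3
    refine ⟨(constantCoeff p)⁻¹, ?_⟩
    rw [map_inv₀, ← key p h3, ← hp, inv_inv]

end

end IterativeEquation

/-! ### The field `ℂ((t))(log t)` -/

namespace IterativeEquation

section

open Polynomial

variable {L : Type*} [Field L]

/-- Let the nonzero elements `l` of `L` with `cⁿ φ(l) = cᵐ l` be such that `n = m` and
`l` is fixed by `φ`. Then the elements of `L(T)` fixed by the endomorphism that extends `φ` and
sends `T` to `c T + u` lie in `L` and are fixed by `φ`. -/
theorem exists_C_of_ratFuncHom_eq_self (φ : L →+* L) (c u : L) (hc : c ≠ 0)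
    (hφ : ∀ (l : L) (n m : ℕ), l ≠ 0 → c ^ n * φ l = c ^ m * l → n = m ∧ φ l = l) {f : RatFunc L}
    (hf : ratFuncHom φ c u hc f = f) : ∃ a, φ a = a ∧ f = RatFunc.C a := by
  set σ : L[X] →+* L[X] := eval₂RingHom (C.comp φ) (C c * X + C u) with hσ
  have hσmap : ∀ p, σ p = (p.map φ).comp (C c * X + C u) := fun p => by
    simp [hσ, Polynomial.comp, eval₂_map]
  have hdeg : ∀ p, (σ p).natDegree = p.natDegree := fun p => by
    rw [hσmap, natDegree_comp, natDegree_linear hc, mul_one, natDegree_map]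
  have hlead : ∀ p, (σ p).leadingCoeff = c ^ p.natDegree * φ p.leadingCoeff := fun p => by
    rw [hσmap, leadingCoeff_comp (by rw [natDegree_linear hc]; exact one_ne_zero),
      leadingCoeff_linear hc, leadingCoeff_map, natDegree_map, mul_comm]
  have hσC : ∀ a, σ (C a) = C (φ a) := fun a => by simp [hσ]
  have key : ∀ (p : L[X]) (m : ℕ), p ≠ 0 → σ p = C (c ^ m) * p →
      p.natDegree = m ∧ φ p.leadingCoeff = p.leadingCoeff := by
    intro p m hp0 hp
    refine hφ _ _ _ (leadingCoeff_ne_zero.mpr hp0) ?_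
    rw [← hlead, hp, leadingCoeff_mul, leadingCoeff_C]
  by_cases hf0 : f = 0
  · exact ⟨0, map_zero _, by rw [hf0, map_zero]⟩
  have hq0 : f.denom ≠ 0 := f.denom_ne_zero
  have hp0 : f.num ≠ 0 := RatFunc.num_ne_zero hf0
  have hσq0 : σ f.denom ≠ 0 := fun h =>
    hq0 (eval₂_linear_injective φ c u hc (h.trans (map_zero _).symm))
  have hcross : σ f.num * f.denom = f.num * σ f.denom := by
    have h1 : algebraMap L[X] (RatFunc L) (σ f.num) / algebraMap L[X] (RatFunc L) (σ f.denom) =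
        algebraMap L[X] (RatFunc L) f.num / algebraMap L[X] (RatFunc L) f.denom := by
      rw [RatFunc.num_div_denom]
      conv_rhs => rw [← hf, ← RatFunc.num_div_denom f, map_div₀, ratFuncHom_algebraMap,
        ratFuncHom_algebraMap]
      rfl
    rw [div_eq_div_iff (RatFunc.algebraMap_ne_zero hσq0) (RatFunc.algebraMap_ne_zero hq0),
      ← map_mul, ← map_mul] at h1
    exact RatFunc.algebraMap_injective L h1
  have hcop : IsCoprime f.denom f.num := f.isCoprime_num_denom.symm
  have hdvd : f.denom ∣ σ f.denom :=
    hcop.dvd_of_dvd_mul_left (Dvd.intro_left _ hcross)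
  set m := f.denom.natDegree with hm
  have hmonic : f.denom.Monic := f.monic_denom
  have hσq : σ f.denom = C (c ^ m) * f.denom := by
    obtain ⟨e, he⟩ := hdvd
    have he0 : e ≠ 0 := by
      rintro rfl
      exact hσq0 (by rw [he, mul_zero])
    have hdege : e.natDegree = 0 := by
      have h1 := hdeg f.denom
      rw [he, natDegree_mul hq0 he0] at h1
      omega
    have hl := hlead f.denom
    rw [he, leadingCoeff_mul, hmonic.leadingCoeff, one_mul, map_one, mul_one] at hl
    rw [he, eq_C_of_natDegree_eq_zero hdege, mul_comm]
    congr 2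
    rw [← hl, leadingCoeff, hdege]
  have hσp : σ f.num = C (c ^ m) * f.num := by
    rw [hσq] at hcross
    exact mul_right_cancel₀ hq0 (by rw [hcross]; ring)
  obtain ⟨hpm, hpl⟩ := key f.num m hp0 hσp
  set a := f.num.leadingCoeff with ha
  have heq : f.num = C a * f.denom := by
    by_contra hne
    have h1 : σ (f.num - C a * f.denom) = C (c ^ m) * (f.num - C a * f.denom) := by
      rw [map_sub, map_mul, hσp, hσq, hσC, hpl]
      ring
    obtain ⟨h2, -⟩ := key _ m (sub_ne_zero.mpr hne) h1
    have h3 : (f.num - C a * f.denom).coeff m = 0 := by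
      rw [coeff_sub, coeff_C_mul, hm, hmonic.coeff_natDegree, mul_one, ← hm, ← hpm,
        coeff_natDegree, ← ha, sub_self]
    rw [← h2, coeff_natDegree, leadingCoeff_eq_zero] at h3
    exact hne (sub_eq_zero.mp h3)
  refine ⟨a, hpl, ?_⟩
  rw [← RatFunc.num_div_denom f]
  nth_rewrite 1 [heq]
  rw [map_mul, RatFunc.algebraMap_C, mul_div_assoc,
    div_self (RatFunc.algebraMap_ne_zero hq0), mul_one]

end

open HahnSeries

/-- `d/dt` as a derivation of `ℂ((t))(log t)`. -/
noncomputable def ddtLogDerivation := ratFuncDerivation ddtDerivation (single (-1 : ℤ) (1 : ℂ))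

lemma ddtLog_toLogField (f : ℂ⸨X⸩) : ddtLog (toLogField f) = toLogField (ddt f) :=
  ratFuncDerivation_C ddtDerivation _ f

section

variable {R : ℂ⟦X⟧} (h0 : PowerSeries.constantCoeff R = 0) (hR : R ≠ 0) (ℓ : ℂ)

lemma PhiLog_toLogField (f : ℂ⸨X⸩) :
    PhiLog R h0 hR ℓ (toLogField f) = toLogField (Phi R h0 hR f) :=
  ratFuncHom_C _ f

lemma derivative_logOf_mul {g : ℂ⟦X⟧} (hg : PowerSeries.constantCoeff g = 1) :
    PowerSeries.derivative ℂ (PowerSeries.logOf g) * g = PowerSeries.derivative ℂ g := by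
  have hs : PowerSeries.HasSubst (g - 1) := hasSubst_of_constantCoeff (by simp [hg])
  have h1 : (1 + PowerSeries.X) * PowerSeries.derivative ℂ (PowerSeries.log ℂ) = 1 := by
    rw [PowerSeries.deriv_log]
    ext n
    rw [add_mul, one_mul, map_add]
    cases n with
    | zero => simp
    | succ n =>
      rw [PowerSeries.coeff_succ_X_mul]
      simp [PowerSeries.coeff_one, pow_succ]
  have h2 := congrArg (PowerSeries.subst (g - 1)) h1
  have hone : PowerSeries.subst (g - 1) (1 : ℂ⟦X⟧) = (1 : ℂ⟦X⟧) := by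
    rw [← PowerSeries.coe_substAlgHom hs, map_one]
  rw [PowerSeries.subst_mul hs, PowerSeries.subst_add hs, PowerSeries.subst_X hs, hone,
    add_sub_cancel] at h2
  rw [PowerSeries.logOf_eq, PowerSeries.derivative_subst hs, map_sub,
    PowerSeries.derivative_one, sub_zero]
  linear_combination (PowerSeries.derivative ℂ g) * h2

lemma X_mul_derivative_X_pow_mul (d : ℕ) (v : ℂ⟦X⟧) :
    PowerSeries.X * PowerSeries.derivative ℂ (PowerSeries.X ^ d * v) =
      (d : ℂ⟦X⟧) * (PowerSeries.X ^ d * v) +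
        PowerSeries.X * (PowerSeries.X ^ d * PowerSeries.derivative ℂ v) := by
  rw [Derivation.leibniz, PowerSeries.derivative_pow, PowerSeries.derivative_X]
  rcases Nat.eq_zero_or_pos d with rfl | h
  · simp
  · obtain ⟨k, rfl⟩ := Nat.exists_eq_succ_of_ne_zero h.ne'
    simp only [smul_eq_mul, Nat.succ_sub_one, pow_succ]
    ring

lemma X_mul_derivative_eq (hR : R ≠ 0) :
    (ord R : ℂ⟦X⟧) * R + PowerSeries.X * R * PowerSeries.derivative ℂ (logUnitPart R ℓ) =
      PowerSeries.X * PowerSeries.derivative ℂ R := by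
  set v := PowerSeries.divXPowOrder R with hv
  have hRv : PowerSeries.X ^ ord R * v = R := PowerSeries.X_pow_order_mul_divXPowOrder
  have hv0 : PowerSeries.constantCoeff v = leadCoeff R := PowerSeries.constantCoeff_divXPowOrder
  have hlead : leadCoeff R ≠ 0 := PowerSeries.coeff_order hR
  set g := PowerSeries.C (leadCoeff R)⁻¹ * v with hg
  have hvg : v = PowerSeries.C (leadCoeff R) * g := by
    rw [hg, ← mul_assoc, ← map_mul, mul_inv_cancel₀ hlead, map_one, one_mul]
  have hg1 : PowerSeries.constantCoeff g = 1 := by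
    rw [hg, map_mul, hv0, PowerSeries.constantCoeff_C, inv_mul_cancel₀ hlead]
  have hlog := derivative_logOf_mul hg1
  have hd : PowerSeries.derivative ℂ (logUnitPart R ℓ) =
      PowerSeries.derivative ℂ (PowerSeries.logOf g) := by
    rw [logUnitPart, map_add, PowerSeries.derivative_C, zero_add]
  have hdR : PowerSeries.X * PowerSeries.derivative ℂ R =
      (ord R : ℂ⟦X⟧) * R + PowerSeries.X * (PowerSeries.X ^ ord R * PowerSeries.derivative ℂ v) := by
    have h := X_mul_derivative_X_pow_mul (ord R) v
    rwa [hRv] at h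
  have hdv : PowerSeries.derivative ℂ v = PowerSeries.C (leadCoeff R) *
      PowerSeries.derivative ℂ g := by
    rw [hvg, Derivation.leibniz, PowerSeries.derivative_C]
    simp
  rw [hdR, hd, hdv, ← hlog]
  have hRg : PowerSeries.X ^ ord R * (PowerSeries.C (leadCoeff R) * g) = R := by rw [← hvg, hRv]
  linear_combination (-PowerSeries.X * PowerSeries.derivative ℂ (PowerSeries.logOf g)) * hRg

lemma ddtLog_PhiLog (f : LogField) : ddtLog (PhiLog R h0 hR ℓ f) =
    toLogField (ofPowerSeries ℤ ℂ (PowerSeries.derivative ℂ R)) * PhiLog R h0 hR ℓ (ddtLog f) := by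
  refine ratFuncDerivation_chain ddtDerivation (single (-1 : ℤ) (1 : ℂ)) ddtLogDerivation
    (PhiLog R h0 hR ℓ) (toLogField (ofPowerSeries ℤ ℂ (PowerSeries.derivative ℂ R)))
    (fun a => ?_) ?_ f
  · change ddtLog (PhiLog R h0 hR ℓ (toLogField a)) =
      _ * PhiLog R h0 hR ℓ (toLogField (ddt a))
    rw [PhiLog_toLogField, PhiLog_toLogField, ddtLog_toLogField, ddt_Phi, map_mul]
  · change _ = _ * PhiLog R h0 hR ℓ (toLogField _)
    have hC : ∀ a, ratFuncDeriv ddtDerivation (single (-1 : ℤ) (1 : ℂ)) (RatFunc.C a) =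
      RatFunc.C (ddt a) := ratFuncDerivation_C _ _
    have hX : ratFuncDeriv ddtDerivation (single (-1 : ℤ) (1 : ℂ)) RatFunc.X =
      RatFunc.C (single (-1 : ℤ) (1 : ℂ)) := ratFuncDerivation_X _ _
    change ratFuncDeriv ddtDerivation (single (-1 : ℤ) (1 : ℂ)) _ = _
    rw [PhiLog_toLogField, PhiLog, ratFuncHom_X, ← map_mul, ratFuncDeriv_add, ratFuncDeriv_mul,
      hC, hC, hX, ddt_C, map_zero, mul_zero, add_zero, ← map_mul, ← map_add, ddt_ofPowerSeries]
    change toLogField _ = toLogField _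
    congr 1
    have hsX : (single (-1 : ℤ) (1 : ℂ) : ℂ⸨X⸩) = (ofPowerSeries ℤ ℂ PowerSeries.X)⁻¹ := by
      apply eq_inv_of_mul_eq_one_left
      rw [PowerSeries.coe_X, single_mul_single]
      simp
    have hX0 : ofPowerSeries ℤ ℂ PowerSeries.X ≠ 0 := by
      rw [PowerSeries.coe_X]
      simp
    have hR0 : ofPowerSeries ℤ ℂ R ≠ 0 := fun h =>
      hR (ofPowerSeries_injective (h.trans (map_zero _).symm))
    rw [hsX, map_inv₀, Phi_ofPowerSeries, PowerSeries.subst_X (hasSubst_of_constantCoeff h0)]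
    have h := congrArg (ofPowerSeries ℤ ℂ) (X_mul_derivative_eq ℓ hR)
    simp only [map_add, map_mul, map_natCast] at h
    rw [map_natCast]
    field_simp
    linear_combination h

end

/-! ### The fixed field of `Φ_R` in `ℂ((t))(log t)` -/

section

variable {R : ℂ⟦X⟧} (h0 : PowerSeries.constantCoeff R = 0) (hR : R ≠ 0) (ℓ : ℂ)

lemma X_sq_dvd (h0 : PowerSeries.constantCoeff R = 0) (h1 : PowerSeries.coeff 1 R = 0) :
    PowerSeries.X ^ 2 ∣ R := by
  rw [PowerSeries.X_pow_dvd_iff]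
  intro m hm
  interval_cases m
  · rwa [PowerSeries.coeff_zero_eq_constantCoeff_apply]
  · exact h1

lemma two_le_ord (hR : R ≠ 0) (hd : PowerSeries.X ^ 2 ∣ R) : 2 ≤ ord R := by
  by_contra! h
  exact PowerSeries.coeff_order hR (PowerSeries.X_pow_dvd_iff.mp hd _ h)

lemma PhiLog_fixed_eq_C (h1 : PowerSeries.coeff 1 R = 0) {f : LogField}
    (hf : PhiLog R h0 hR ℓ f = f) : ∃ a, f = toLogField (C a) := by
  have hd := X_sq_dvd h0 h1
  have hord := two_le_ord hR hd
  have hne : (ord R : ℂ) ≠ 0 := Nat.cast_ne_zero.mpr (by omega)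
  obtain ⟨g, hg, rfl⟩ := exists_C_of_ratFuncHom_eq_self _ _ _ _ (fun l n m hl h => by
    have h2 : Phi R h0 hR l = C ((ord R : ℂ) ^ m / (ord R : ℂ) ^ n) * l := by
      rw [map_div₀, div_mul_eq_mul_div, eq_div_iff ((map_ne_zero _).mpr (pow_ne_zero n hne)),
        map_pow, map_pow, ← h, mul_comm]
    obtain ⟨h3, -⟩ := Phi_semiinvariant_eq_C h0 hR hd hl
      (div_ne_zero (pow_ne_zero m hne) (pow_ne_zero n hne)) h2
    refine ⟨?_, by rw [h2, h3, map_one, one_mul]⟩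
    rw [div_eq_one_iff_eq (pow_ne_zero n hne)] at h3
    exact (Nat.pow_right_injective hord (by exact_mod_cast h3)).symm) hf
  by_cases hg0 : g = 0
  · exact ⟨0, by rw [hg0, map_zero, map_zero, map_zero]⟩
  obtain ⟨-, a, rfl⟩ := Phi_semiinvariant_eq_C h0 hR hd hg0 one_ne_zero
    (by rw [hg, map_one, one_mul])
  exact ⟨a, rfl⟩

end

end IterativeEquation

/-! ### Logarithmic derivatives and partial fractions in `ℂ(t)` -/

namespace IterativeEquation

section

variable {F : Type*} [Field F] (δ : Derivation ℤ F F)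

lemma derivation_add (x y : F) : δ (x + y) = δ x + δ y := map_add δ x y

lemma derivation_sub (x y : F) : δ (x - y) = δ x - δ y := map_sub δ x y

lemma derivation_mul (x y : F) : δ (x * y) = x * δ y + y * δ x := by
  rw [Derivation.leibniz, smul_eq_mul, smul_eq_mul]

lemma derivation_pow (x : F) (n : ℕ) : δ (x ^ n) = n * x ^ (n - 1) * δ x := by
  rw [Derivation.leibniz_pow, nsmul_eq_mul, smul_eq_mul, mul_assoc]

lemma derivation_inv (x : F) : δ x⁻¹ = -x⁻¹ ^ 2 * δ x := by
  rw [Derivation.leibniz_inv, smul_eq_mul]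

lemma logDeriv_mul {x y : F} (hx : x ≠ 0) (hy : y ≠ 0) :
    δ (x * y) / (x * y) = δ x / x + δ y / y := by
  rw [derivation_mul]
  field_simp
  ring

lemma logDeriv_inv (x : F) : δ x⁻¹ / x⁻¹ = -(δ x / x) := by
  by_cases hx : x = 0
  · simp [hx]
  · rw [derivation_inv]
    field_simp

lemma logDeriv_pow (x : F) (n : ℕ) : δ (x ^ n) / x ^ n = n * (δ x / x) := by
  by_cases hx : x = 0
  · rcases Nat.eq_zero_or_pos n with rfl | h
    · simp
    · simp [hx, h.ne']
  induction n with
  | zero => simp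
  | succ n ih =>
    rw [pow_succ, logDeriv_mul δ (pow_ne_zero n hx) hx, ih]
    push_cast
    ring

lemma logDeriv_zpow (x : F) (n : ℤ) : δ (x ^ n) / x ^ n = n * (δ x / x) := by
  obtain ⟨k, rfl | rfl⟩ := n.eq_nat_or_neg
  · simpa using logDeriv_pow δ x k
  · rw [zpow_neg, logDeriv_inv, zpow_natCast, logDeriv_pow]
    push_cast
    ring

end

open RatFunc in
/-- The rational function `∑ r_α / (t - α)`. -/
noncomputable def polarSum (r : ℂ →₀ ℂ) : RatFunc ℂ :=
  r.sum fun α c => C c * (X - C α)⁻¹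

lemma polarSum_add (r s : ℂ →₀ ℂ) : polarSum (r + s) = polarSum r + polarSum s :=
  Finsupp.sum_add_index' (by simp) (by simp [add_mul])

lemma polarSum_zero : polarSum 0 = 0 := Finsupp.sum_zero_index

lemma polarSum_neg (r : ℂ →₀ ℂ) : polarSum (-r) = -polarSum r := by
  rw [eq_neg_iff_add_eq_zero, ← polarSum_add, neg_add_cancel, polarSum_zero]

lemma polarSum_sub (r s : ℂ →₀ ℂ) : polarSum (r - s) = polarSum r - polarSum s := by
  rw [sub_eq_add_neg, polarSum_add, polarSum_neg, sub_eq_add_neg]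

lemma polarSum_single (α c : ℂ) :
    polarSum (Finsupp.single α c) = RatFunc.C c * (RatFunc.X - RatFunc.C α)⁻¹ :=
  Finsupp.sum_single_index (by simp)

lemma polarSum_smul (c : ℂ) (r : ℂ →₀ ℂ) : polarSum (c • r) = RatFunc.C c * polarSum r := by
  induction r using Finsupp.induction_linear with
  | zero => simp [polarSum_zero]
  | add r s hr hs => rw [smul_add, polarSum_add, polarSum_add, hr, hs, mul_add]
  | single α a => rw [Finsupp.smul_single, polarSum_single, polarSum_single, smul_eq_mul, map_mul,
      mul_assoc]

lemma polarSum_finsuppSum (r : ℂ →₀ ℂ) (g : ℂ → ℂ → ℂ →₀ ℂ) :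
    polarSum (r.sum g) = r.sum fun α c => polarSum (g α c) :=
  map_finsuppSum (AddMonoidHom.mk' polarSum polarSum_add) r g

/-- The expansion at the point `α`. -/
noncomputable def expansionAt (α : ℂ) : RatFunc ℂ →+* ℂ⸨X⸩ :=
  expansion.comp (ratFuncHom (RingHom.id ℂ) 1 α one_ne_zero)

lemma expansionAt_C (α c : ℂ) : expansionAt α (RatFunc.C c) = HahnSeries.C c := by
  rw [expansionAt, RingHom.comp_apply, ratFuncHom_C, expansion_C, RingHom.id_apply]

lemma expansionAt_X (α : ℂ) : expansionAt α RatFunc.X =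
    HahnSeries.ofPowerSeries ℤ ℂ (PowerSeries.X + PowerSeries.C α) := by
  rw [expansionAt, RingHom.comp_apply, ratFuncHom_X, map_add, map_mul, expansion_C, expansion_X,
    expansion_C, map_one, one_mul, map_add, PowerSeries.coe_C]

@[simp] lemma ratDeriv_C (c : ℂ) : ratDeriv (RatFunc.C c) = 0 := by
  rw [ratDeriv, ratFuncDerivation_C]
  simp

@[simp] lemma ratDeriv_X : ratDeriv RatFunc.X = 1 := by
  rw [ratDeriv, ratFuncDerivation_X, map_one]

lemma ddt_expansionAt (α : ℂ) (f : RatFunc ℂ) :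
    ddt (expansionAt α f) = expansionAt α (ratDeriv f) := by
  have h := ratFuncDerivation_chain (0 : Derivation ℤ ℂ ℂ) 1 ddtDerivation (expansionAt α) 1
    (fun a => by rw [expansionAt_C]; simp [-HahnSeries.C_apply]) (by
      rw [expansionAt_X, coe_ddtDerivation, ddt_ofPowerSeries]
      simp) f
  rw [one_mul] at h
  exact h

/-- The residue at `α`. -/
noncomputable def residue (α : ℂ) : RatFunc ℂ →+ ℂ :=
  AddMonoidHom.mk' (fun f => (expansionAt α f).coeff (-1)) fun f g => by
    rw [map_add, HahnSeries.coeff_add]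

lemma residue_ratDeriv (α : ℂ) (f : RatFunc ℂ) : residue α (ratDeriv f) = 0 := by
  change (expansionAt α (ratDeriv f)).coeff (-1) = 0
  rw [← ddt_expansionAt, ddt_coeff]
  simp

lemma residue_C_mul_inv (α β c : ℂ) :
    residue α (RatFunc.C c * (RatFunc.X - RatFunc.C β)⁻¹) = if β = α then c else 0 := by
  change (expansionAt α _).coeff (-1) = _
  rw [map_mul, map_inv₀, map_sub, expansionAt_C, expansionAt_C, expansionAt_X,
    ← PowerSeries.coe_C β, ← map_sub, HahnSeries.C_mul_eq_smul, HahnSeries.coeff_smul, smul_eq_mul]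
  split_ifs with h
  · subst h
    rw [add_sub_cancel_right, PowerSeries.coe_X, HahnSeries.inv_single]
    simp
  · have hu : IsUnit (PowerSeries.X + PowerSeries.C α - PowerSeries.C β : ℂ⟦X⟧) := by
      rw [PowerSeries.isUnit_iff_constantCoeff, isUnit_iff_ne_zero]
      simpa [sub_eq_zero] using Ne.symm h
    obtain ⟨v, hv⟩ := hu
    have hinv : (HahnSeries.ofPowerSeries ℤ ℂ (v : ℂ⟦X⟧))⁻¹ =
        HahnSeries.ofPowerSeries ℤ ℂ (↑v⁻¹ : ℂ⟦X⟧) := by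
      rw [inv_eq_iff_eq_inv]
      apply eq_inv_of_mul_eq_one_left
      rw [← map_mul, Units.mul_inv, map_one]
    rw [← hv, hinv, PowerSeries.coeff_coe]
    simp

lemma residue_polarSum (α : ℂ) (r : ℂ →₀ ℂ) : residue α (polarSum r) = r α := by
  induction r using Finsupp.induction_linear with
  | zero => simp [polarSum_zero]
  | add r s hr hs => rw [polarSum_add, map_add, hr, hs, Finsupp.add_apply]
  | single β c =>
    classical
    rw [polarSum_single, residue_C_mul_inv, Finsupp.single_apply]

/-- The functions `1 / (t - α)` are linearly independent modulo derivatives. -/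
lemma eq_zero_of_ratDeriv_add_polarSum_eq_zero {g : RatFunc ℂ} {r : ℂ →₀ ℂ}
    (h : ratDeriv g + polarSum r = 0) : r = 0 := by
  ext α
  have h1 := congrArg (residue α) h
  rwa [map_add, residue_ratDeriv, residue_polarSum, zero_add, map_zero] at h1

lemma X_sub_C_ne_zero (α : ℂ) : (RatFunc.X - RatFunc.C α : RatFunc ℂ) ≠ 0 := by
  rw [← RatFunc.algebraMap_X, ← RatFunc.algebraMap_C, ← map_sub]
  exact RatFunc.algebraMap_ne_zero (Polynomial.X_sub_C_ne_zero α)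

lemma ratDeriv_X_sub_C (α : ℂ) : ratDeriv (RatFunc.X - RatFunc.C α) = 1 := by
  rw [derivation_sub, ratDeriv_X, ratDeriv_C, sub_zero]

lemma algebraMap_eq_prod (p : Polynomial ℂ) :
    algebraMap (Polynomial ℂ) (RatFunc ℂ) p = RatFunc.C p.leadingCoeff *
      (p.roots.map fun α => (RatFunc.X - RatFunc.C α : RatFunc ℂ)).prod := by
  conv_lhs => rw [(IsAlgClosed.splits p).eq_prod_roots]
  rw [map_mul, RatFunc.algebraMap_C, map_multiset_prod, Multiset.map_map]
  congr 3
  ext α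
  simp

/-- The logarithmic derivative of a rational function has simple poles and integer residues. -/
lemma exists_logDeriv_eq_polarSum {v : RatFunc ℂ} (hv : v ≠ 0) :
    ∃ m : ℂ →₀ ℤ, ratDeriv v / v = polarSum (m.mapRange (fun k : ℤ => (k : ℂ)) Int.cast_zero) := by
  have hadd : ∀ m n : ℂ →₀ ℤ, (m + n).mapRange (fun k : ℤ => (k : ℂ)) Int.cast_zero =
      m.mapRange (fun k : ℤ => (k : ℂ)) Int.cast_zero +
        n.mapRange (fun k : ℤ => (k : ℂ)) Int.cast_zero := fun m n =>
    Finsupp.mapRange_add (by simp) m n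
  have hneg : ∀ m : ℂ →₀ ℤ, (-m).mapRange (fun k : ℤ => (k : ℂ)) Int.cast_zero =
      -m.mapRange (fun k : ℤ => (k : ℂ)) Int.cast_zero := fun m =>
    Finsupp.mapRange_neg (by simp) m
  have hC : ∀ c : ℂ, ∃ m : ℂ →₀ ℤ, ratDeriv (RatFunc.C c) / RatFunc.C c =
      polarSum (m.mapRange (fun k : ℤ => (k : ℂ)) Int.cast_zero) := fun c =>
    ⟨0, by simp [polarSum_zero]⟩
  have hprod : ∀ s : Multiset ℂ, (s.map fun α => (RatFunc.X - RatFunc.C α : RatFunc ℂ)).prod ≠ 0 ∧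
      ∃ m : ℂ →₀ ℤ, ratDeriv (s.map fun α => (RatFunc.X - RatFunc.C α : RatFunc ℂ)).prod /
        (s.map fun α => (RatFunc.X - RatFunc.C α : RatFunc ℂ)).prod =
          polarSum (m.mapRange (fun k : ℤ => (k : ℂ)) Int.cast_zero) := by
    intro s
    induction s using Multiset.induction_on with
    | empty =>
      refine ⟨by simp, ?_⟩
      rw [Multiset.map_zero, Multiset.prod_zero, ← map_one RatFunc.C]
      exact hC 1
    | cons α s ih =>
      obtain ⟨h0, m, hm⟩ := ih
      rw [Multiset.map_cons, Multiset.prod_cons]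
      refine ⟨mul_ne_zero (X_sub_C_ne_zero α) h0, Finsupp.single α 1 + m, ?_⟩
      rw [logDeriv_mul _ (X_sub_C_ne_zero α) h0, hm, hadd, polarSum_add, Finsupp.mapRange_single,
        polarSum_single, ratDeriv_X_sub_C, Int.cast_one, map_one, one_mul, one_div]
  have hpoly : ∀ p : Polynomial ℂ, p ≠ 0 → ∃ m : ℂ →₀ ℤ,
      ratDeriv (algebraMap (Polynomial ℂ) (RatFunc ℂ) p) / algebraMap (Polynomial ℂ) (RatFunc ℂ) p =
        polarSum (m.mapRange (fun k : ℤ => (k : ℂ)) Int.cast_zero) := by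
    intro p hp
    obtain ⟨h0, m, hm⟩ := hprod p.roots
    refine ⟨m, ?_⟩
    rw [algebraMap_eq_prod, logDeriv_mul _
      ((map_ne_zero _).mpr (Polynomial.leadingCoeff_ne_zero.mpr hp)) h0, ratDeriv_C, zero_div,
      zero_add, hm]
  obtain ⟨m, hm⟩ := hpoly v.num (RatFunc.num_ne_zero hv)
  obtain ⟨n, hn⟩ := hpoly v.denom v.denom_ne_zero
  refine ⟨m + -n, ?_⟩
  rw [hadd, hneg, polarSum_add, polarSum_neg, ← hm, ← hn, ← logDeriv_inv,
    ← logDeriv_mul _ (RatFunc.algebraMap_ne_zero (RatFunc.num_ne_zero hv))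
      (inv_ne_zero (RatFunc.algebraMap_ne_zero v.denom_ne_zero)), ← div_eq_mul_inv,
    RatFunc.num_div_denom]

/-- The elementary fractions. -/
def elementaryFractions : Set (RatFunc ℂ) :=
  {f | ∃ (c : ℂ) (n : ℕ), f = RatFunc.C c * RatFunc.X ^ n} ∪
    {f | ∃ (c α : ℂ) (n : ℕ), f = RatFunc.C c * (RatFunc.X - RatFunc.C α)⁻¹ ^ (n + 1)}

lemma C_mul_mem_closure (c : ℂ) {f : RatFunc ℂ} (hf : f ∈ AddSubmonoid.closure elementaryFractions) :
    RatFunc.C c * f ∈ AddSubmonoid.closure elementaryFractions := by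
  induction hf using AddSubmonoid.closure_induction with
  | zero => rw [mul_zero]; exact zero_mem _
  | add f g _ _ hf hg => rw [mul_add]; exact add_mem hf hg
  | mem f hf =>
    apply AddSubmonoid.subset_closure
    rcases hf with ⟨d, n, rfl⟩ | ⟨d, α, n, rfl⟩
    · exact Or.inl ⟨c * d, n, by rw [map_mul, mul_assoc]⟩
    · exact Or.inr ⟨c * d, α, n, by rw [map_mul, mul_assoc]⟩

lemma inv_mul_mem_closure (β : ℂ) {f : RatFunc ℂ}
    (hf : f ∈ AddSubmonoid.closure elementaryFractions) :
    (RatFunc.X - RatFunc.C β)⁻¹ * f ∈ AddSubmonoid.closure elementaryFractions := by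
  set A := AddSubmonoid.closure elementaryFractions with hA
  have hX : ∀ n : ℕ, RatFunc.X ^ n ∈ A := fun n =>
    AddSubmonoid.subset_closure (Or.inl ⟨1, n, by rw [map_one, one_mul]⟩)
  have hinv : ∀ (α : ℂ) (n : ℕ), (RatFunc.X - RatFunc.C α)⁻¹ ^ (n + 1) ∈ A := fun α n =>
    AddSubmonoid.subset_closure (Or.inr ⟨1, α, n, by rw [map_one, one_mul]⟩)
  have hXn : ∀ n : ℕ, (RatFunc.X - RatFunc.C β)⁻¹ * RatFunc.X ^ n ∈ A := by
    intro n
    induction n with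
    | zero => simpa using hinv β 0
    | succ n ih =>
      have h0 := X_sub_C_ne_zero β
      have e : (RatFunc.X - RatFunc.C β)⁻¹ * RatFunc.X ^ (n + 1) = RatFunc.X ^ n +
          RatFunc.C β * ((RatFunc.X - RatFunc.C β)⁻¹ * RatFunc.X ^ n) := by
        field_simp
        ring
      rw [e]
      exact add_mem (hX n) (C_mul_mem_closure β ih)
  have hinvn : ∀ (α : ℂ) (n : ℕ),
      (RatFunc.X - RatFunc.C β)⁻¹ * (RatFunc.X - RatFunc.C α)⁻¹ ^ n ∈ A := by
    intro α n
    by_cases hαβ : α = β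
    · rw [hαβ, ← pow_succ']
      exact hinv β n
    induction n with
    | zero => simpa using hinv β 0
    | succ n ih =>
      have h0 := X_sub_C_ne_zero β
      have h1 := X_sub_C_ne_zero α
      have h2 : (RatFunc.C β - RatFunc.C α : RatFunc ℂ) ≠ 0 := by
        rw [← map_sub]
        exact (map_ne_zero _).mpr (sub_ne_zero.mpr (Ne.symm hαβ))
      have e : (RatFunc.X - RatFunc.C β)⁻¹ * (RatFunc.X - RatFunc.C α)⁻¹ ^ (n + 1) =
          RatFunc.C (β - α)⁻¹ * ((RatFunc.X - RatFunc.C β)⁻¹ * (RatFunc.X - RatFunc.C α)⁻¹ ^ n) +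
          RatFunc.C (-(β - α)⁻¹) * (RatFunc.X - RatFunc.C α)⁻¹ ^ (n + 1) := by
        have hxy : (RatFunc.X - RatFunc.C β)⁻¹ * (RatFunc.X - RatFunc.C α)⁻¹ =
            (RatFunc.C β - RatFunc.C α)⁻¹ *
              ((RatFunc.X - RatFunc.C β)⁻¹ - (RatFunc.X - RatFunc.C α)⁻¹) := by
          field_simp
          ring
        rw [map_neg, map_inv₀, map_sub]
        linear_combination (RatFunc.X - RatFunc.C α)⁻¹ ^ n * hxy
      rw [e]
      exact add_mem (C_mul_mem_closure _ ih) (C_mul_mem_closure _ (hinv α n))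
  induction hf using AddSubmonoid.closure_induction with
  | zero => rw [mul_zero]; exact zero_mem _
  | add f g _ _ hf hg => rw [mul_add]; exact add_mem hf hg
  | mem f hf =>
    rcases hf with ⟨c, n, rfl⟩ | ⟨c, α, n, rfl⟩
    · rw [mul_left_comm]
      exact C_mul_mem_closure c (hXn n)
    · rw [mul_left_comm]
      exact C_mul_mem_closure c (hinvn α (n + 1))

lemma mem_closure_elementaryFractions (f : RatFunc ℂ) :
    f ∈ AddSubmonoid.closure elementaryFractions := by
  have hpoly : ∀ p : Polynomial ℂ, algebraMap (Polynomial ℂ) (RatFunc ℂ) p ∈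
      AddSubmonoid.closure elementaryFractions := by
    intro p
    induction p using Polynomial.induction_on' with
    | add p q hp hq => rw [map_add]; exact add_mem hp hq
    | monomial n a =>
      refine AddSubmonoid.subset_closure (Or.inl ⟨a, n, ?_⟩)
      rw [← Polynomial.C_mul_X_pow_eq_monomial, map_mul, map_pow, RatFunc.algebraMap_C,
        RatFunc.algebraMap_X]
  have hprod : ∀ s : Multiset ℂ, ∀ f ∈ AddSubmonoid.closure elementaryFractions,
      ((s.map fun α => (RatFunc.X - RatFunc.C α : RatFunc ℂ)).prod)⁻¹ * f ∈
        AddSubmonoid.closure elementaryFractions := by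
    intro s
    induction s using Multiset.induction_on with
    | empty => intro f hf; simpa using hf
    | cons α s ih =>
      intro f hf
      rw [Multiset.map_cons, Multiset.prod_cons, mul_inv, mul_assoc]
      exact inv_mul_mem_closure α (ih f hf)
  rw [← RatFunc.num_div_denom f, div_eq_inv_mul, algebraMap_eq_prod f.denom, mul_inv, ← map_inv₀,
    mul_assoc]
  exact C_mul_mem_closure _ (hprod _ _ (hpoly _))

/-- A rational function is the sum of a derivative and a function with simple poles. -/
lemma exists_eq_ratDeriv_add_polarSum (f : RatFunc ℂ) :
    ∃ (g : RatFunc ℂ) (r : ℂ →₀ ℂ), f = ratDeriv g + polarSum r := by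
  have hCmul : ∀ (c : ℂ) (g : RatFunc ℂ), ratDeriv (RatFunc.C c * g) = RatFunc.C c * ratDeriv g := by
    intro c g
    rw [derivation_mul, ratDeriv_C, mul_zero, add_zero]
  have hcast : ∀ n : ℕ, (n + 1 : RatFunc ℂ) ≠ 0 := fun n => by
    rw [← map_one RatFunc.C, ← map_natCast RatFunc.C, ← map_add]
    exact (map_ne_zero _).mpr (Nat.cast_add_one_ne_zero n)
  induction mem_closure_elementaryFractions f using AddSubmonoid.closure_induction with
  | zero =>
    refine ⟨RatFunc.C 0, 0, ?_⟩
    rw [ratDeriv_C, polarSum_zero, add_zero]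
  | add f g _ _ hf hg =>
    obtain ⟨g₁, r₁, rfl⟩ := hf
    obtain ⟨g₂, r₂, rfl⟩ := hg
    refine ⟨g₁ + g₂, r₁ + r₂, ?_⟩
    rw [derivation_add, polarSum_add]
    ring
  | mem f hf =>
    rcases hf with ⟨c, n, rfl⟩ | ⟨c, α, n, rfl⟩
    · refine ⟨RatFunc.C (c * ((n : ℂ) + 1)⁻¹) * RatFunc.X ^ (n + 1), 0, ?_⟩
      rw [hCmul, derivation_pow, ratDeriv_X, polarSum_zero, map_mul, map_inv₀, map_add, map_one,
        map_natCast]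
      have := hcast n
      push_cast
      field_simp
      simp
    · cases n with
      | zero =>
        refine ⟨RatFunc.C 0, Finsupp.single α c, ?_⟩
        rw [ratDeriv_C, polarSum_single, zero_add, zero_add, pow_one]
      | succ n =>
        refine ⟨RatFunc.C (-(c * ((n : ℂ) + 1)⁻¹)) * (RatFunc.X - RatFunc.C α)⁻¹ ^ (n + 1), 0, ?_⟩
        rw [hCmul, derivation_pow, derivation_inv, ratDeriv_X_sub_C, polarSum_zero, map_neg,
          map_mul, map_inv₀, map_add, map_one, map_natCast]
        have hN := inv_mul_cancel₀ (hcast n)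
        rw [Nat.add_sub_cancel]
        push_cast
        linear_combination (-RatFunc.C c * (RatFunc.X - RatFunc.C α)⁻¹ ^ (n + 2)) * hN

end IterativeEquation

/-! ### Rational logarithmic derivatives of solutions of `Φ_R z = a z` -/

namespace IterativeEquation

lemma exists_mul_sum_eq_logDeriv (r : ℂ → ℂ) (hr : ∀ α, ∃ q : ℚ, (q : ℂ) = r α) (S : Finset ℂ) :
    ∃ N : ℕ, 0 < N ∧ ∃ v : RatFunc ℂ, v ≠ 0 ∧
      (N : RatFunc ℂ) * ∑ α ∈ S, RatFunc.C (r α) * (RatFunc.X - RatFunc.C α)⁻¹ =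
        ratDeriv v / v := by
  classical
  induction S using Finset.induction_on with
  | empty =>
    refine ⟨1, one_pos, RatFunc.C 1, by simp, ?_⟩
    rw [ratDeriv_C]
    simp
  | insert α S hα ih =>
    obtain ⟨N, hN, v, hv, h⟩ := ih
    obtain ⟨q, hq⟩ := hr α
    have hx := X_sub_C_ne_zero α
    have hqd : RatFunc.C (r α) * (q.den : RatFunc ℂ) = (q.num : RatFunc ℂ) := by
      rw [← map_natCast (RatFunc.C : ℂ →+* RatFunc ℂ), ← map_intCast (RatFunc.C : ℂ →+* RatFunc ℂ),
        ← map_mul, ← hq]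
      congr 1
      exact_mod_cast Rat.mul_den_eq_num q
    refine ⟨N * q.den, Nat.mul_pos hN q.den_pos,
      (RatFunc.X - RatFunc.C α) ^ (q.num * N) * v ^ q.den,
      mul_ne_zero (zpow_ne_zero _ hx) (pow_ne_zero _ hv), ?_⟩
    rw [Finset.sum_insert hα, logDeriv_mul _ (zpow_ne_zero _ hx) (pow_ne_zero _ hv), logDeriv_zpow,
      logDeriv_pow, ratDeriv_X_sub_C, ← h]
    push_cast
    rw [← hqd, one_div]
    ring

/-- A complex number killed by all `ℚ`-linear forms that kill `1` is rational. -/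
lemma exists_ratCast_eq {x : ℂ} (hx : ∀ l : ℂ →ₗ[ℚ] ℚ, l 1 = 0 → l x = 0) :
    ∃ q : ℚ, (q : ℂ) = x := by
  by_contra h
  have hmem : x ∉ Submodule.span ℚ {(1 : ℂ)} := by
    rw [Submodule.mem_span_singleton]
    rintro ⟨q, hq⟩
    exact h ⟨q, by rw [← hq, Rat.smul_def, mul_one]⟩
  obtain ⟨l, hl, hle⟩ := Submodule.exists_le_ker_of_notMem hmem
  exact hl (hx l (hle (Submodule.mem_span_singleton_self 1)))

/-- The operator on residue data given by `[α] ↦ ∑ k, m α k [k]`. -/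
noncomputable def residueTransfer (m : ℂ → ℂ →₀ ℤ) (r : ℂ →₀ ℂ) : ℂ →₀ ℂ :=
  r.sum fun α c => c • (m α).mapRange (fun k : ℤ => (k : ℂ)) Int.cast_zero

lemma residueTransfer_mapRange (m : ℂ → ℂ →₀ ℤ) (l : ℂ →+ ℂ) (s : ℂ →₀ ℂ) :
    residueTransfer m (s.mapRange l (map_zero l)) =
      (residueTransfer m s).mapRange l (map_zero l) := by
  induction s using Finsupp.induction_linear with
  | zero => simp [residueTransfer]
  | add s t hs ht =>
    have hadd : ∀ s t, residueTransfer m (s + t) = residueTransfer m s + residueTransfer m t :=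
      fun s t => Finsupp.sum_add_index' (by simp) (by simp [add_smul])
    rw [Finsupp.mapRange_add (map_add l), hadd, hs, ht, hadd, Finsupp.mapRange_add (map_add l)]
  | single β c =>
    have hsingle : ∀ β c, residueTransfer m (Finsupp.single β c) =
        c • (m β).mapRange (fun k : ℤ => (k : ℂ)) Int.cast_zero :=
      fun β c => Finsupp.sum_single_index (by simp)
    rw [Finsupp.mapRange_single, hsingle, hsingle]
    ext γ
    simp only [Finsupp.smul_apply, Finsupp.mapRange_apply, smul_eq_mul]
    rw [mul_comm, ← zsmul_eq_mul, ← map_zsmul, zsmul_eq_mul, mul_comm]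

/-- If the residue transfer has no nonzero fixed point, then a solution of
`residueTransfer m r = r + n` with integral `n` is rational. -/
lemma exists_ratCast_eq_of_residueTransfer (m : ℂ → ℂ →₀ ℤ)
    (hfix : ∀ s, residueTransfer m s = s → s = 0) {r : ℂ →₀ ℂ} {n : ℂ →₀ ℤ}
    (hr : residueTransfer m r = r + n.mapRange (fun k : ℤ => (k : ℂ)) Int.cast_zero) (α : ℂ) :
    ∃ q : ℚ, (q : ℂ) = r α := by
  refine exists_ratCast_eq fun l hl => ?_
  let l' : ℂ →+ ℂ := (Rat.castHom ℂ).toAddMonoidHom.comp l.toAddMonoidHom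
  have hl' : ∀ k : ℤ, l' (k : ℂ) = 0 := by
    intro k
    rw [← mul_one (k : ℂ), ← zsmul_eq_mul, map_zsmul]
    simp [l', hl]
  have h0 := hfix (r.mapRange l' (map_zero l')) (by
    rw [residueTransfer_mapRange, hr, Finsupp.mapRange_add (map_add l')]
    ext γ
    simp [hl'])
  simpa [l'] using DFunLike.congr_fun h0 α

/-- `R' Φ_R` acts on sums of simple poles through the zeros and poles of the `R - α`. -/
lemma derivative_mul_Phi_polarSum {R : ℂ⟦X⟧} (h0 : PowerSeries.constantCoeff R = 0) (hR : R ≠ 0)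
    {ρ : RatFunc ℂ} (hρ : expansion ρ = HahnSeries.ofPowerSeries ℤ ℂ R) {m : ℂ → ℂ →₀ ℤ}
    (hm : ∀ α, ratDeriv (ρ - RatFunc.C α) / (ρ - RatFunc.C α) =
      polarSum ((m α).mapRange (fun k : ℤ => (k : ℂ)) Int.cast_zero)) (r : ℂ →₀ ℂ) :
    HahnSeries.ofPowerSeries ℤ ℂ (PowerSeries.derivative ℂ R) *
      Phi R h0 hR (expansion (polarSum r)) = expansion (polarSum (residueTransfer m r)) := by
  rw [residueTransfer, polarSum_finsuppSum, polarSum, Finsupp.sum, Finsupp.sum, map_sum, map_sum,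
    map_sum, Finset.mul_sum]
  refine Finset.sum_congr rfl fun α _ => ?_
  have hd : ratDeriv (ρ - RatFunc.C α) = ratDeriv ρ := by
    rw [derivation_sub, ratDeriv_C, sub_zero]
  rw [polarSum_smul, ← hm α, hd]
  simp only [map_mul, map_inv₀, map_sub, map_div₀, expansion_C, Phi_C, expansion_X,
    Phi_ofPowerSeries, PowerSeries.subst_X (hasSubst_of_constantCoeff h0), hρ, ← ddt_expansion,
    ddt_ofPowerSeries]
  ring

/-- If `R' Φ_R(w) = w` has no nonzero rational solution, then a rational solution `h` of
`R' Φ_R(h) = h + a' / a` is a rational multiple of a logarithmic derivative. -/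
theorem exists_nat_mul_eq_logDeriv {R : ℂ⟦X⟧} (h0 : PowerSeries.constantCoeff R = 0) (hR : R ≠ 0)
    (hrat : HahnSeries.ofPowerSeries ℤ ℂ R ∈ expansion.range)
    (hzero : ∀ w : RatFunc ℂ, HahnSeries.ofPowerSeries ℤ ℂ (PowerSeries.derivative ℂ R) *
      Phi R h0 hR (expansion w) = expansion w → w = 0)
    {a h : RatFunc ℂ} (ha : a ≠ 0)
    (hh : HahnSeries.ofPowerSeries ℤ ℂ (PowerSeries.derivative ℂ R) * Phi R h0 hR (expansion h) =
      expansion h + expansion (ratDeriv a / a)) :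
    ∃ N : ℕ, 0 < N ∧ ∃ v : RatFunc ℂ, v ≠ 0 ∧ (N : RatFunc ℂ) * h = ratDeriv v / v := by
  obtain ⟨ρ, hρ⟩ := hrat
  have hinj : Function.Injective expansion := expansion.injective
  have hρne : ∀ α, ρ - RatFunc.C α ≠ 0 := by
    intro α hα
    rw [sub_eq_zero.mp hα, expansion_C, ← PowerSeries.coe_C] at hρ
    have h1 := HahnSeries.ofPowerSeries_injective hρ
    rw [← h1, PowerSeries.constantCoeff_C] at h0
    apply hR
    rw [← h1, h0, map_zero]
  choose m hm using fun α => exists_logDeriv_eq_polarSum (hρne α)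
  obtain ⟨n, hn⟩ := exists_logDeriv_eq_polarSum ha
  have hT := derivative_mul_Phi_polarSum h0 hR hρ hm
  obtain ⟨g, r, rfl⟩ := exists_eq_ratDeriv_add_polarSum h
  obtain ⟨g₁, hg₁⟩ := Phi_expansion_mem h0 hR ⟨ρ, hρ⟩ g
  have hg : HahnSeries.ofPowerSeries ℤ ℂ (PowerSeries.derivative ℂ R) *
      Phi R h0 hR (expansion (ratDeriv g)) = expansion (ratDeriv g₁) := by
    rw [← ddt_expansion, ← ddt_expansion, hg₁, ddt_Phi]
  obtain ⟨n', hn'⟩ : ∃ n', n' = n.mapRange (fun k : ℤ => (k : ℂ)) Int.cast_zero := ⟨_, rfl⟩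
  rw [← hn'] at hn
  have hmain : ratDeriv g₁ + polarSum (residueTransfer m r) =
      ratDeriv g + polarSum r + polarSum n' := by
    apply hinj
    rw [map_add, map_add _ (ratDeriv g + polarSum r), ← hg, ← hT, ← mul_add, ← map_add, ← map_add,
      hh, hn]
  have hTr : residueTransfer m r = r + n' := by
    have h1 : ratDeriv (g₁ - g) + polarSum (residueTransfer m r - (r + n')) = 0 := by
      rw [derivation_sub, polarSum_sub, polarSum_add]
      linear_combination hmain
    exact sub_eq_zero.mp (eq_zero_of_ratDeriv_add_polarSum_eq_zero h1)
  have hgg : ratDeriv g₁ = ratDeriv g := by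
    rw [hTr, polarSum_add] at hmain
    linear_combination hmain
  rw [hzero (ratDeriv g) (hg.trans (by rw [hgg])), zero_add]
  refine exists_mul_sum_eq_logDeriv r
    (exists_ratCast_eq_of_residueTransfer m (fun s hs => ?_) (hTr.trans (by rw [hn']))) r.support
  have hz := hzero (polarSum s) (by rw [hT, hs])
  exact eq_zero_of_ratDeriv_add_polarSum_eq_zero (g := RatFunc.C 0)
    (by rw [ratDeriv_C, hz, add_zero])

/-! ### Proof of the main theorem -/

lemma IsDiffAlgebraic.map {K E F : Type*} [Field K] [Field E] [Field F] {j : K →+* E} {D : E → E}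
    {D' : F → F} (ι : E →+* F) (hι : ∀ x, D' (ι x) = ι (D x)) {f : E} (hf : IsDiffAlgebraic j D f) :
    IsDiffAlgebraic (ι.comp j) D' (ι f) := by
  obtain ⟨n, P, hP, h⟩ := hf
  refine ⟨n, P, hP, ?_⟩
  have hiter : ∀ i : ℕ, D'^[i] (ι f) = ι (D^[i] f) := by
    intro i
    induction i with
    | zero => rfl
    | succ i ih => rw [Function.iterate_succ_apply', Function.iterate_succ_apply', ih, hι]
  simp only [hiter]
  have := MvPolynomial.eval₂_comp_left ι j (fun i : Fin (n + 1) => D^[(i : ℕ)] f) P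
  rw [h, map_zero] at this
  exact this.symm

/-- The main theorem in a field `F ⊇ ℂ((t))` containing a differentially transcendental solution of
`Φ Ψ = R' Ψ`, where `Φ` extends `Φ_R` and has fixed field `ℂ`. -/
theorem exists_pow_mem_range_of_isDiffAlgebraic {R : ℂ⟦X⟧} (h0 : PowerSeries.constantCoeff R = 0)
    (hR : R ≠ 0) (hrat : HahnSeries.ofPowerSeries ℤ ℂ R ∈ expansion.range)
    {F : Type*} [Field F] (ι : ℂ⸨X⸩ →+* F) (δ : Derivation ℤ F F) (Φ : F →+* F)
    (hδι : ∀ f, δ (ι f) = ι (ddt f)) (hΦι : ∀ f, Φ (ι f) = ι (Phi R h0 hR f))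
    (hchain : ∀ x, δ (Φ x) =
      ι (HahnSeries.ofPowerSeries ℤ ℂ (PowerSeries.derivative ℂ R)) * Φ (δ x))
    (hfix : ∀ x, Φ x = x → ∃ c, x = ι (HahnSeries.C c)) {Ψ : F}
    (hΨ : Φ Ψ = ι (HahnSeries.ofPowerSeries ℤ ℂ (PowerSeries.derivative ℂ R)) * Ψ)
    (hΨt : IsDiffTranscendental (ι.comp expansion) δ Ψ) {a : RatFunc ℂ} {z : ℂ⸨X⸩} (hz0 : z ≠ 0)
    (hz : Phi R h0 hR z = expansion a * z) (hzalg : IsDiffAlgebraic expansion ddt z) :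
    ∃ N : ℕ, 0 < N ∧ z ^ N ∈ expansion.range := by
  let _ : Algebra (RatFunc ℂ) F := (ι.comp expansion).toAlgebra
  have hmap : ∀ k, algebraMap (RatFunc ℂ) F k = ι (expansion k) := fun _ => rfl
  have hrange : ∀ f ∈ expansion.range, ι f ∈ (algebraMap (RatFunc ℂ) F).range := by
    rintro _ ⟨k, rfl⟩
    exact ⟨k, rfl⟩
  have : CharZero F :=
    charZero_of_injective_ringHom (ι.comp HahnSeries.C).injective
  have hind := (isDiffTranscendental_iff (K := RatFunc ℂ) δ Ψ).mp hΨt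
  have hδK : ∀ k, δ (algebraMap (RatFunc ℂ) F k) ∈ (algebraMap (RatFunc ℂ) F).range := by
    intro k
    rw [hmap, hδι, ddt_expansion]
    exact ⟨_, rfl⟩
  have hΦK : ∀ k, Φ (algebraMap (RatFunc ℂ) F k) ∈ (algebraMap (RatFunc ℂ) F).range := by
    intro k
    rw [hmap, hΦι]
    exact hrange _ (Phi_expansion_mem h0 hR hrat k)
  set ρ := HahnSeries.ofPowerSeries ℤ ℂ (PowerSeries.derivative ℂ R) with hρ
  have hρ0 : ρ ≠ 0 := fun h => derivative_ne_zero_of_constantCoeff_eq_zero h0 hR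
    (HahnSeries.ofPowerSeries_injective (h.trans (map_zero _).symm))
  have ha0 : expansion a ≠ 0 := by
    intro h
    rw [h, zero_mul] at hz
    exact hz0 ((map_eq_zero _).mp hz)
  have hzalg' : ¬ AlgebraicIndependent (RatFunc ℂ) fun i : ℕ => δ^[i] (ι z) := fun h =>
    (isDiffTranscendental_iff (K := RatFunc ℂ) δ (ι z)).mpr h (hzalg.map ι hδι)
  obtain ⟨M, hMfg, hzM, hM⟩ := exists_fg_differential_subfield δ hδK hzalg'
  have hyM : ι (ddt z / z) ∈ M := by
    rw [map_div₀, ← hδι]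
    exact M.div_mem (hM _ hzM) hzM
  have hyb : ρ * Phi R h0 hR (ddt z / z) = ddt z / z + expansion (ratDeriv a / a) := by
    have h1 := ddt_Phi h0 hR z
    rw [hz, ddt_mul, ddt_expansion] at h1
    rw [map_div₀, hz, mul_div_assoc', ← h1, map_div₀]
    field_simp
  obtain ⟨h, hh⟩ := mem_range_of_mul_map_eq_add δ hδK Φ hΦK
    (fun x hx => by
      obtain ⟨c, rfl⟩ := hfix x hx
      exact hrange _ ⟨RatFunc.C c, expansion_C c⟩)
    (hrange ρ (derivative_mem_range hrat)) ((map_ne_zero ι).mpr hρ0) hchain hΨ hind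
    ⟨M, hMfg, hyM, hM⟩ ⟨ratDeriv a / a, rfl⟩ (by rw [hΦι, ← map_mul, hyb, map_add]; rfl)
  have hzh : ddt z / z = expansion h := ι.injective hh.symm
  have hzero : ∀ w : RatFunc ℂ, ρ * Phi R h0 hR (expansion w) = expansion w → w = 0 := by
    intro w hw
    by_contra hw0
    have hw0' : ι (expansion w) ≠ 0 := (map_ne_zero ι).mpr ((map_ne_zero _).mpr hw0)
    obtain ⟨c, hc⟩ := hfix (Ψ * ι (expansion w)) (by
      rw [map_mul, hΨ, hΦι]
      conv_rhs => rw [← hw, map_mul]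
      ring)
    refine hind.transcendental 0 ?_
    change IsAlgebraic (RatFunc ℂ) Ψ
    have hΨ' : Ψ = algebraMap (RatFunc ℂ) F (RatFunc.C c / w) := by
      rw [hmap, map_div₀, map_div₀, expansion_C, ← hc, mul_div_cancel_right₀ _ hw0']
    rw [hΨ']
    exact isAlgebraic_algebraMap _
  obtain ⟨N, hN, v, hv, hNv⟩ := exists_nat_mul_eq_logDeriv h0 hR hrat hzero
    (a := a) (h := h) (fun h => ha0 (by rw [h, map_zero])) (by rw [← hzh]; exact hyb)
  refine ⟨N, hN, ?_⟩
  have hv' : expansion v ≠ 0 := (map_ne_zero _).mpr hv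
  have hd : ddt (z ^ N * (expansion v)⁻¹) = 0 := by
    have h1 := logDeriv_mul ddtDerivation (pow_ne_zero N hz0) (inv_ne_zero hv')
    rw [logDeriv_pow, logDeriv_inv, coe_ddtDerivation, hzh, ddt_expansion, ← map_div₀, ← hNv,
      map_mul, map_natCast, add_neg_cancel, div_eq_zero_iff] at h1
    exact h1.resolve_right (mul_ne_zero (pow_ne_zero N hz0) (inv_ne_zero hv'))
  have hC := eq_C_of_ddt_eq_zero hd
  refine ⟨RatFunc.C ((z ^ N * (expansion v)⁻¹).coeff 0) * v, ?_⟩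
  rw [map_mul, expansion_C, ← hC, inv_mul_cancel_right₀ hv']

end IterativeEquation

theorem mainTheorem6 (R : PowerSeries ℂ) (hR : IterativeEquation.DT R) (a : RatFunc ℂ)
    (z : LaurentSeries ℂ)
    (hz : IterativeEquation.Phi R hR.map_zero hR.ne_zero z = IterativeEquation.expansion a * z) :
    (IsAlgebraic (RatFunc ℂ) z ∧
        ∃ N : ℕ, 0 < N ∧ z ^ N ∈ IterativeEquation.expansion.range) ∨
      IterativeEquation.IsDiffTranscendental IterativeEquation.expansion IterativeEquation.ddt z := by
  open IterativeEquation in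
  rw [or_iff_not_imp_right]
  intro hzalg
  rw [IsDiffTranscendental, not_not] at hzalg
  suffices h : ∃ N : ℕ, 0 < N ∧ z ^ N ∈ expansion.range by
    refine ⟨?_, h⟩
    obtain ⟨N, hN, k, hk⟩ := h
    refine IsAlgebraic.of_pow hN ?_
    rw [← hk]
    exact isAlgebraic_algebraMap k
  by_cases hz0 : z = 0
  · exact ⟨1, one_pos, 0, by rw [hz0, map_zero, pow_one]⟩
  obtain ⟨h1, Ψ, hΨ, hΨt⟩ | ⟨h1, ℓ, -, Ψ, hΨ, hΨt⟩ := hR.exists_psi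
  · exact exists_pow_mem_range_of_isDiffAlgebraic hR.map_zero hR.ne_zero hR.rational
      (RingHom.id _) ddtDerivation (Phi R hR.map_zero hR.ne_zero) (fun _ => rfl) (fun _ => rfl)
      (ddt_Phi hR.map_zero hR.ne_zero)
      (fun x hx => Phi_fixed_eq_C hR.map_zero hR.ne_zero hR.iter_ne hx) hΨ hΨt hz0 hz hzalg
  · exact exists_pow_mem_range_of_isDiffAlgebraic hR.map_zero hR.ne_zero hR.rational
      toLogField ddtLogDerivation (PhiLog R hR.map_zero hR.ne_zero ℓ) ddtLog_toLogField
      (PhiLog_toLogField hR.map_zero hR.ne_zero ℓ) (ddtLog_PhiLog hR.map_zero hR.ne_zero ℓ)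
      (fun x hx => PhiLog_fixed_eq_C hR.map_zero hR.ne_zero ℓ h1 hx) hΨ hΨt hz0 hz hzalg
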